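/- Let $0<s<1/2$ and $d\ge 2$. For a real-valued function $u$ on $\mathbb R^d$ with weak gradient $\partial u=(\partial_{x_1}u,\dots,\partial_{x_d}u)$ put $$\|u\|_{H^{1+s}(\mathbb R^d)}=\|u\|_{H^1(\mathbb R^d)}+\Bigl(\int_{\mathbb R^d}\int_{\mathbb R^d}\frac{|\partial u(x)-\partial u(y)|^2}{|x-y|^{d+2s}}\,dx\,dy\Bigr)^{1/2},\qquad \|u\|_{H^1(\mathbb R^d)}^2=\|u\|_{L^2(\mathbb R^d)}^2+\|\partial u\|_{L^2(\mathbb R^d)}^2,$$ and let $H^{1+s}(\mathbb R^d)$ be the space of those $u$ for which this is finite. Then there is a constant $C>0$, depending only on $s$ and $d$, such that for every $u\in H^{1+s}(\mathbb R^d)$ the positive part $u^+=\max\{u,0\}$ belongs to $H^{1+s}(\mathbb R^d)$ and $$\|u^+\|_{H^{1+s}(\mathbb R^d)}\le C\,\|u\|_{H^{1+s}(\mathbb R^d)}.$$ -/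

import Mathlib

open MeasureTheory
open scoped ENNReal NNReal

namespace FracSobolev

/-- `G` is a weak gradient on `ℝ^d` of the real-valued function `u`: both are locally integrable and
`∫ u ∂_j φ = - ∫ G_j φ` for every coordinate `j` and every smooth compactly supported `φ`. -/
structure IsWeakGradient {d : ℕ} (u : EuclideanSpace ℝ (Fin d) → ℝ)
    (G : EuclideanSpace ℝ (Fin d) → EuclideanSpace ℝ (Fin d)) : Prop where
  locallyIntegrable : LocallyIntegrable u volume
  locallyIntegrable_grad : LocallyIntegrable G volume
  integral_eq : ∀ (j : Fin d) (φ : EuclideanSpace ℝ (Fin d) → ℝ),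
    ContDiff ℝ (⊤ : ℕ∞) φ → HasCompactSupport φ →
      ∫ x, u x * fderiv ℝ φ x (EuclideanSpace.single j (1 : ℝ)) = - ∫ x, G x j * φ x

/-- The nonlocal seminorm
`‖G‖_{Ḣ^γ} = (∫∫ |G(x) - G(y)|² / |x - y|^{d + 2γ} dx dy)^{1/2}` on `ℝ^d`, for a vector field `G`. -/
noncomputable def gagliardoSeminorm {d : ℕ} (γ : ℝ)
    (G : EuclideanSpace ℝ (Fin d) → EuclideanSpace ℝ (Fin d)) : ℝ≥0∞ :=
  (∫⁻ x, ∫⁻ y, ENNReal.ofReal (‖G x - G y‖ ^ 2 / ‖x - y‖ ^ ((d : ℝ) + 2 * γ))) ^ (1 / 2 : ℝ)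

/-- The `H^1(ℝ^d)` norm of `u`, computed with the gradient `G`. -/
noncomputable def h1NormWith {d : ℕ} (u : EuclideanSpace ℝ (Fin d) → ℝ)
    (G : EuclideanSpace ℝ (Fin d) → EuclideanSpace ℝ (Fin d)) : ℝ≥0∞ :=
  (eLpNorm u 2 volume ^ 2 + eLpNorm G 2 volume ^ 2) ^ (1 / 2 : ℝ)

/-- The norm `‖u‖_{H^{1+γ}(ℝ^d)} = ‖u‖_{H^1} + ‖∂u‖_{Ḣ^γ}`, where `∂u` is the weak gradient of `u`.
The weak gradient is unique up to a null set, so the infimum runs over a single value;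
it is `∞` if `u` has no weak gradient. -/
noncomputable def sobolevNorm {d : ℕ} (γ : ℝ) (u : EuclideanSpace ℝ (Fin d) → ℝ) : ℝ≥0∞ :=
  ⨅ (G : EuclideanSpace ℝ (Fin d) → EuclideanSpace ℝ (Fin d)) (_ : IsWeakGradient u G),
    h1NormWith u G + gagliardoSeminorm γ G

/-- `u` belongs to `H^{1+γ}(ℝ^d)`. -/
def MemSobolev {d : ℕ} (γ : ℝ) (u : EuclideanSpace ℝ (Fin d) → ℝ) : Prop :=
  sobolevNorm γ u < ∞

/-- The Nemytskii operator `u ↦ u⁺ = max {u, 0}`. -/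
noncomputable def positivePart {d : ℕ} (u : EuclideanSpace ℝ (Fin d) → ℝ) :
    EuclideanSpace ℝ (Fin d) → ℝ :=
  fun x => max (u x) 0

end FracSobolev

/-! The weak gradient of u⁺ is 1_{u>0} ∂u, so the H¹ part of the norm does not increase, and the
issue is the Gagliardo seminorm of the truncated gradient. Nothing is known about the regularity of
{u > 0}; the proof relies instead on the truncated field being again a gradient, and on the
structure of ∂_j u on lines.

Reduction to one dimension. By Plancherel the energy of f is a constant times ∫ |ξ|^{2s} |f̂|².
Summed over the components of a gradient ∂w this is a constant times ∫ |ξ|^{2+2s} |ŵ|², and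
|ξ|^{2+2s} ≤ d^s Σ_j |ξ_j|^{2+2s}. Hence it suffices to control, for each j, the energy of ∂_j w in
the single direction e_j (`sum_gagliardoEnergy_le`, applied to w = u⁺). In return, one directional
energy of ∂_j u is bounded by its full energy, since |ξ_j| ≤ |ξ| (`axisEnergy_le`). A directional
energy is an integral of line energies, and on almost every line parallel to the axis u agrees a.e.
with an absolutely continuous v with v' = g in L² (`exists_ac_representative_on_lines`).

On a line (`lineEnergy_indicator_le`). In the energy of 1_{v>0} g only pairs x ∈ {v > 0}, y ∉ {v >
0} cost anything new, namely ∫_{v>0} g² times the kernel mass of {v ≤ 0}. For x in a component I of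
{v > 0} the complement lies beyond the ends of I, so that mass is at most a constant times the sum
of dist^{-2s} to the finite ends, and a fractional Hardy inequality applies. On a bounded interval
Hardy has an L² remainder; since v vanishes at both ends, g has mean zero on I and a Poincaré
inequality absorbs it. On a half-line the remainder disappears by scaling, and for I = ℝ there is no
tail. The constants do not depend on I, so the components can be summed.

Hardy itself (`hardy_step`). Compare f(x) with f(lx) and average over l ∈ (L, 2L). The differences
are paid for by the energy; the dilated term returns with factor 2 l^{2s-1}, which is at most 1/2
for large L because s < 1/2, and is absorbed. -/

namespace FracSobolev

open Set

/-! ### Fractional Hardy and Poincaré inequalities on intervals -/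

/-- The Gagliardo energy of order `s` of `f : ℝ → ℝ` over `S × S`. -/
noncomputable def lineEnergy (s : ℝ) (S : Set ℝ) (f : ℝ → ℝ) : ℝ≥0∞ :=
  ∫⁻ x in S, ∫⁻ y in S, ENNReal.ofReal ((f x - f y) ^ 2 / |x - y| ^ (1 + 2 * s))

theorem lintegral_comp_mul_left {l : ℝ} (hl : 0 < l) {F : ℝ → ℝ≥0∞} (hF : Measurable F) :
    ∫⁻ x, F (l * x) = ENNReal.ofReal l⁻¹ * ∫⁻ x, F x := by
  rw [← lintegral_map hF (measurable_const_mul l), Real.map_volume_mul_left hl.ne',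
    lintegral_smul_measure, abs_of_pos (inv_pos.2 hl), smul_eq_mul]

/-- Since |x - lx| ≤ 2Lx, the weight x^{-2s} is at most (2L)^{1+2s} x / |x - lx|^{1+2s}. The extra
factor x is the Jacobian needed when l is replaced by y = lx as the variable of integration. -/
theorem sq_mul_rpow_le_of_dilate {s : ℝ} (f : ℝ → ℝ) {x l L : ℝ} (hs : 0 < s)
    (hx : 0 < x) (hL : 2 ≤ L) (hl : l ∈ Ioo L (2 * L)) :
    f x ^ 2 * x ^ (-(2 * s)) ≤
      2 * (2 * L) ^ (1 + 2 * s) * (x * ((f x - f (l * x)) ^ 2 / |x - l * x| ^ (1 + 2 * s))) +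
      2 * l ^ (2 * s) * (f (l * x) ^ 2 * (l * x) ^ (-(2 * s))) := by
  have hl0 : 0 < l := by linarith [hl.1]
  have e1 : l ^ (2 * s) * (f (l * x) ^ 2 * (l * x) ^ (-(2 * s))) =
      f (l * x) ^ 2 * x ^ (-(2 * s)) := by
    rw [Real.mul_rpow hl0.le hx.le, Real.rpow_neg hl0.le]
    have := (Real.rpow_pos_of_pos hl0 (2 * s)).ne'
    field_simp
  have e2 : (f x - f (l * x)) ^ 2 * x ^ (-(2 * s)) ≤
      (2 * L) ^ (1 + 2 * s) * (x * ((f x - f (l * x)) ^ 2 / |x - l * x| ^ (1 + 2 * s))) := by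
    have h1 : |x - l * x| ≤ 2 * L * x := by
      rw [abs_le]; constructor <;> nlinarith [hl.1, hl.2]
    have h0 : 0 < |x - l * x| := by
      rw [abs_pos]; nlinarith [hl.1, hl.2]
    have h2 : |x - l * x| ^ (1 + 2 * s) ≤ (2 * L) ^ (1 + 2 * s) * x ^ (1 + 2 * s) := by
      rw [← Real.mul_rpow (by linarith) hx.le]
      exact Real.rpow_le_rpow h0.le h1 (by linarith)
    have h3 : x ^ (1 + 2 * s) * x ^ (-(2 * s)) = x := by
      rw [← Real.rpow_add hx]; simp
    have hp := Real.rpow_pos_of_pos h0 (1 + 2 * s)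
    have hq := Real.rpow_pos_of_pos hx (-(2 * s))
    rw [← mul_div_assoc, ← mul_div_assoc, le_div_iff₀ hp]
    calc (f x - f (l * x)) ^ 2 * x ^ (-(2 * s)) * |x - l * x| ^ (1 + 2 * s)
        ≤ (f x - f (l * x)) ^ 2 * x ^ (-(2 * s)) * ((2 * L) ^ (1 + 2 * s) * x ^ (1 + 2 * s)) := by
          gcongr
      _ = (f x - f (l * x)) ^ 2 * (2 * L) ^ (1 + 2 * s) * (x ^ (1 + 2 * s) * x ^ (-(2 * s))) := by
          ring
      _ = _ := by rw [h3]; ring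
  have hq := Real.rpow_pos_of_pos hx (-(2 * s))
  have e3 : f x ^ 2 * x ^ (-(2 * s)) ≤ 2 * ((f x - f (l * x)) ^ 2 * x ^ (-(2 * s))) +
      2 * (f (l * x) ^ 2 * x ^ (-(2 * s))) := by
    have : f x ^ 2 ≤ 2 * (f x - f (l * x)) ^ 2 + 2 * f (l * x) ^ 2 := by
      nlinarith [sq_nonneg (f x - 2 * f (l * x))]
    nlinarith
  rw [mul_assoc 2 (l ^ (2 * s)), e1]
  linarith

theorem measurable_lineKernel {f : ℝ → ℝ} (hf : Measurable f) (s : ℝ) :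
    Measurable fun p : ℝ × ℝ =>
      ENNReal.ofReal ((f p.1 - f p.2) ^ 2 / |p.1 - p.2| ^ (1 + 2 * s)) := by
  fun_prop

/-- The place where s < 1/2 is decisive: l^{2s-1} tends to 0. The threshold 4^{1/(1-2s)} is where
l^{1-2s} reaches 4. -/
theorem exists_dilation {s : ℝ} (hs1 : s < 1 / 2) :
    ∃ L : ℝ, 2 ≤ L ∧ ∀ l, L ≤ l → 2 * l ^ (2 * s) * l⁻¹ ≤ 1 / 2 := by
  refine ⟨max 2 (4 ^ (1 / (1 - 2 * s))), le_max_left _ _, fun l hl => ?_⟩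
  have hl2 : 4 ^ (1 / (1 - 2 * s)) ≤ l := (le_max_right _ _).trans hl
  have hl0 : 0 < l := by linarith [(le_max_left (2 : ℝ) (4 ^ (1 / (1 - 2 * s)))).trans hl]
  have h4 : (4 : ℝ) ≤ l ^ (1 - 2 * s) := by
    have := Real.rpow_le_rpow (z := 1 - 2 * s) (by positivity) hl2 (by linarith)
    rwa [← Real.rpow_mul (by norm_num), one_div_mul_cancel (by linarith), Real.rpow_one] at this
  have e : l ^ (2 * s) * l⁻¹ = (l ^ (1 - 2 * s))⁻¹ := by
    rw [← Real.rpow_neg_one, ← Real.rpow_add hl0, ← Real.rpow_neg hl0.le]; congr 1; ring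
  rw [mul_assoc, e]
  have := inv_anti₀ (by norm_num) h4
  linarith

/-- The absorbed form of the fractional Hardy inequality on `(0, b)`, away from the origin. -/
theorem hardy_step {s L ε b : ℝ} (hs : 0 < s) (hL : 2 ≤ L)
    (hLs : ∀ l, L ≤ l → 2 * l ^ (2 * s) * l⁻¹ ≤ 1 / 2) (hε : 0 < ε) (hb : 0 < b)
    {f : ℝ → ℝ} (hf : Measurable f) :
    ∫⁻ x in Ioo ε (b / (2 * L)), ENNReal.ofReal (f x ^ 2 * x ^ (-(2 * s))) ≤
      ENNReal.ofReal (2 * (2 * L) ^ (1 + 2 * s) / L) * lineEnergy s (Ioo 0 b) f +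
      ENNReal.ofReal (1 / 2) * ∫⁻ x in Ioo ε b, ENNReal.ofReal (f x ^ 2 * x ^ (-(2 * s))) := by
  have hL0 : 0 < L := by linarith
  set A := ∫⁻ x in Ioo ε b, ENNReal.ofReal (f x ^ 2 * x ^ (-(2 * s))) with hA
  set B := ∫⁻ x in Ioo ε (b / (2 * L)), ENNReal.ofReal (f x ^ 2 * x ^ (-(2 * s))) with hB
  set c := 2 * (2 * L) ^ (1 + 2 * s) with hc
  have hc0 : 0 ≤ c := by positivity
  -- The upper limit b/(2L) keeps lx below b, and l ≥ 1 keeps it above ε, so the dilated term is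
  -- again an integral over (ε, b).
  have key : ∀ x ∈ Ioo ε (b / (2 * L)), ∀ l ∈ Ioo L (2 * L), l * x ∈ Ioo ε b := by
    intro x hx l hl
    have hx0 : 0 < x := hε.trans hx.1
    refine ⟨?_, ?_⟩
    · nlinarith [hx.1, hl.1]
    · have := hx.2; rw [lt_div_iff₀ (by positivity)] at this
      nlinarith [hl.2]
  set W : ℝ → ℝ≥0∞ := (Ioo ε b).indicator fun y => ENNReal.ofReal (f y ^ 2 * y ^ (-(2 * s)))
  have hW : Measurable W := Measurable.indicator (by fun_prop) measurableSet_Ioo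
  set K : ℝ → ℝ → ℝ≥0∞ := fun x => (Ioo 0 b).indicator fun y =>
    ENNReal.ofReal ((f x - f y) ^ 2 / |x - y| ^ (1 + 2 * s))
  have hK : Measurable (Function.uncurry K) := by
    have : Function.uncurry K = (Prod.snd ⁻¹' (Ioo 0 b)).indicator fun p : ℝ × ℝ =>
        ENNReal.ofReal ((f p.1 - f p.2) ^ 2 / |p.1 - p.2| ^ (1 + 2 * s)) := by
      ext ⟨x, y⟩; simp [K, indicator, Function.uncurry]
    rw [this]
    exact (measurable_lineKernel hf s).indicator (measurable_snd measurableSet_Ioo)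
  have hKx : ∀ x, Measurable (K x) := fun x => hK.comp measurable_prodMk_left
  have pt : ∀ x ∈ Ioo ε (b / (2 * L)), ∀ l ∈ Ioo L (2 * L),
      ENNReal.ofReal (f x ^ 2 * x ^ (-(2 * s))) ≤
        ENNReal.ofReal (c * x) * K x (l * x) + ENNReal.ofReal (2 * l ^ (2 * s)) * W (l * x) := by
    intro x hx l hl
    have hx0 : 0 < x := hε.trans hx.1
    have hl0 : 0 < l := by linarith [hl.1]
    have hm := key x hx l hl
    have hm' : l * x ∈ Ioo 0 b := ⟨hε.trans hm.1, hm.2⟩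
    simp only [K, W, indicator_of_mem hm, indicator_of_mem hm']
    rw [← ENNReal.ofReal_mul (by positivity), ← ENNReal.ofReal_mul (by positivity),
      ← ENNReal.ofReal_add (by positivity) (by positivity)]
    apply ENNReal.ofReal_le_ofReal
    have := sq_mul_rpow_le_of_dilate f hs hx0 hL hl
    rwa [← mul_assoc (2 * (2 * L) ^ (1 + 2 * s)) x, ← hc] at this
  have hvol : volume (Ioo L (2 * L)) = ENNReal.ofReal L := by
    rw [Real.volume_Ioo]; congr 1; ring
  have h1 : ENNReal.ofReal L * B ≤ ∫⁻ x in Ioo ε (b / (2 * L)), ∫⁻ l in Ioo L (2 * L),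
      (ENNReal.ofReal (c * x) * K x (l * x) + ENNReal.ofReal (2 * l ^ (2 * s)) * W (l * x)) := by
    rw [hB, ← lintegral_const_mul _ (by fun_prop)]
    refine setLIntegral_mono' measurableSet_Ioo fun x hx => ?_
    rw [mul_comm, ← hvol, ← setLIntegral_const]
    exact setLIntegral_mono' measurableSet_Ioo fun l hl => pt x hx l hl
  have m1 : Measurable fun p : ℝ × ℝ => ENNReal.ofReal (c * p.1) * K p.1 (p.2 * p.1) := by
    have : Measurable fun p : ℝ × ℝ => K p.1 (p.2 * p.1) :=
      hK.comp (measurable_fst.prodMk (measurable_snd.mul measurable_fst))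
    fun_prop
  have m2 : Measurable fun p : ℝ × ℝ => ENNReal.ofReal (2 * p.2 ^ (2 * s)) * W (p.2 * p.1) := by
    fun_prop
  -- For fixed x the substitution y = lx produces x⁻¹, which cancels the factor x.
  have h2 : ∫⁻ x in Ioo ε (b / (2 * L)), ∫⁻ l in Ioo L (2 * L),
      ENNReal.ofReal (c * x) * K x (l * x) ≤ ENNReal.ofReal c * lineEnergy s (Ioo 0 b) f := by
    rw [lineEnergy, ← lintegral_const_mul _ (by
      exact (measurable_lineKernel hf s).lintegral_prod_right')]
    have hsub : Ioo ε (b / (2 * L)) ⊆ Ioo 0 b := fun x hx => ⟨hε.trans hx.1,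
      hx.2.trans_le (div_le_self hb.le (by linarith))⟩
    refine (lintegral_mono_set hsub).trans ?_
    refine setLIntegral_mono' measurableSet_Ioo fun x hx => ?_
    have hx0 : 0 < x := hx.1
    calc ∫⁻ l in Ioo L (2 * L), ENNReal.ofReal (c * x) * K x (l * x)
        ≤ ∫⁻ l, ENNReal.ofReal (c * x) * K x (x * l) := by
          simp_rw [mul_comm x]; exact setLIntegral_le_lintegral _ _
      _ = ENNReal.ofReal (c * x) * (ENNReal.ofReal x⁻¹ * ∫⁻ y, K x y) := by
          rw [lintegral_const_mul, lintegral_comp_mul_left hx0 (hKx x)]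
          exact (hKx x).comp (measurable_const_mul x)
      _ = ENNReal.ofReal c * ∫⁻ y, K x y := by
          rw [← mul_assoc, ← ENNReal.ofReal_mul (by positivity), mul_assoc,
            mul_inv_cancel₀ hx0.ne', mul_one]
      _ = _ := by rw [lintegral_indicator measurableSet_Ioo]
  -- For fixed l the substitution y = lx produces l⁻¹, so the coefficient is 2 l^{2s-1} ≤ 1/2; the
  -- l-interval has length L.
  have h3 : ∫⁻ x in Ioo ε (b / (2 * L)), ∫⁻ l in Ioo L (2 * L),
      ENNReal.ofReal (2 * l ^ (2 * s)) * W (l * x) ≤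
      ENNReal.ofReal L * (ENNReal.ofReal (1 / 2) * A) := by
    rw [lintegral_lintegral_swap m2.aemeasurable, mul_comm (ENNReal.ofReal L), ← hvol,
      ← setLIntegral_const]
    refine setLIntegral_mono' measurableSet_Ioo fun l hl => ?_
    have hl0 : 0 < l := by linarith [hl.1]
    calc ∫⁻ x in Ioo ε (b / (2 * L)), ENNReal.ofReal (2 * l ^ (2 * s)) * W (l * x)
        ≤ ∫⁻ x, ENNReal.ofReal (2 * l ^ (2 * s)) * W (l * x) := setLIntegral_le_lintegral _ _
      _ = ENNReal.ofReal (2 * l ^ (2 * s)) * (ENNReal.ofReal l⁻¹ * ∫⁻ y, W y) := by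
          rw [lintegral_const_mul _ (by fun_prop), lintegral_comp_mul_left hl0 hW]
      _ = ENNReal.ofReal (2 * l ^ (2 * s) * l⁻¹) * A := by
          rw [← mul_assoc, ← ENNReal.ofReal_mul (by positivity), hA,
            lintegral_indicator measurableSet_Ioo]
      _ ≤ _ := by gcongr; exact hLs l hl.1.le
  have h4 : ENNReal.ofReal L * B ≤ ENNReal.ofReal L *
      (ENNReal.ofReal (c / L) * lineEnergy s (Ioo 0 b) f + ENNReal.ofReal (1 / 2) * A) := by
    calc _ ≤ _ := h1
      _ = (∫⁻ x in Ioo ε (b / (2 * L)), ∫⁻ l in Ioo L (2 * L),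
            ENNReal.ofReal (c * x) * K x (l * x)) +
          ∫⁻ x in Ioo ε (b / (2 * L)), ∫⁻ l in Ioo L (2 * L),
            ENNReal.ofReal (2 * l ^ (2 * s)) * W (l * x) := by
          rw [← lintegral_add_left m1.lintegral_prod_right']
          refine lintegral_congr fun x => ?_
          exact lintegral_add_left (m1.comp measurable_prodMk_left) _
      _ ≤ _ := by
          rw [mul_add, ← mul_assoc, ← ENNReal.ofReal_mul hL0.le, mul_div_cancel₀ _ hL0.ne']
          exact add_le_add h2 h3
  exact (ENNReal.mul_le_mul_iff_right (by simpa using hL0) ENNReal.ofReal_ne_top).1 h4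

/-- The fractional Hardy inequality on `(0, b)` for `s < 1 / 2`. -/
theorem hardy_Ioo_zero {s : ℝ} (hs : 0 < s) (hs1 : s < 1 / 2) : ∃ C : ℝ≥0, ∀ b : ℝ, 0 < b →
    ∀ f : ℝ → ℝ, Measurable f → ∫⁻ x in Ioo 0 b, ENNReal.ofReal (f x ^ 2) ≠ ∞ →
    ∫⁻ x in Ioo 0 b, ENNReal.ofReal (f x ^ 2 * x ^ (-(2 * s))) ≤
      C * (lineEnergy s (Ioo 0 b) f +
        ENNReal.ofReal (b ^ (-(2 * s))) * ∫⁻ x in Ioo 0 b, ENNReal.ofReal (f x ^ 2)) := by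
  obtain ⟨L, hL, hLs⟩ := exists_dilation hs1
  have hL0 : 0 < L := by linarith
  set c₁ := 2 * (2 * L) ^ (1 + 2 * s) / L
  set c₂ := (2 * L) ^ (2 * s)
  refine ⟨Real.toNNReal (2 * max c₁ c₂), fun b hb f hf hfin => ?_⟩
  set N := ∫⁻ x in Ioo 0 b, ENNReal.ofReal (f x ^ 2)
  set R := (lineEnergy s (Ioo 0 b) f + ENNReal.ofReal (b ^ (-(2 * s))) * N)
  have hε : ∀ ε, 0 < ε → ∫⁻ x in Ioo ε b, ENNReal.ofReal (f x ^ 2 * x ^ (-(2 * s))) ≤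
      ENNReal.ofReal (2 * max c₁ c₂) * R := by
    intro ε hε
    set A := ∫⁻ x in Ioo ε b, ENNReal.ofReal (f x ^ 2 * x ^ (-(2 * s))) with hA
    have low : ∀ a > 0, ∫⁻ x in Ioo a b, ENNReal.ofReal (f x ^ 2 * x ^ (-(2 * s))) ≤
        ENNReal.ofReal (a ^ (-(2 * s))) * N := by
      intro a ha
      rw [← lintegral_const_mul _ (by fun_prop)]
      refine le_trans ?_ (lintegral_mono_set (Ioo_subset_Ioo_left ha.le))
      refine setLIntegral_mono' measurableSet_Ioo fun x hx => ?_
      rw [← ENNReal.ofReal_mul (by positivity), mul_comm]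
      apply ENNReal.ofReal_le_ofReal
      refine mul_le_mul_of_nonneg_right ?_ (sq_nonneg _)
      exact Real.rpow_le_rpow_of_nonpos ha hx.1.le (by linarith)
    -- The cut-off at ε serves this: A must be finite for half of it to be subtracted from both
    -- sides.
    have hAfin : A ≠ ∞ := ne_top_of_le_ne_top (ENNReal.mul_ne_top ENNReal.ofReal_ne_top hfin)
      (low ε hε)
    have hbL : 0 < b / (2 * L) := by positivity
    -- Beyond b/(2L) the weight is at most c₂ b^{-2s}, so that part goes into the L² remainder.
    have split : A ≤ (∫⁻ x in Ioo ε (b / (2 * L)), ENNReal.ofReal (f x ^ 2 * x ^ (-(2 * s)))) +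
        ENNReal.ofReal (c₂ * b ^ (-(2 * s))) * N := by
      have : Ioo ε b ⊆ Ioo ε (b / (2 * L)) ∪ Ici (b / (2 * L)) ∩ Ioo 0 b := by
        intro x hx
        by_cases h : x < b / (2 * L)
        · exact Or.inl ⟨hx.1, h⟩
        · exact Or.inr ⟨not_lt.1 h, hε.trans hx.1, hx.2⟩
      refine (lintegral_mono_set this).trans ((lintegral_union_le _ _ _).trans ?_)
      gcongr
      rw [← lintegral_const_mul _ (by fun_prop)]
      refine le_trans ?_ (lintegral_mono_set (inter_subset_right (s := Ici (b / (2 * L)))))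
      refine setLIntegral_mono' (measurableSet_Ici.inter measurableSet_Ioo) fun x hx => ?_
      rw [← ENNReal.ofReal_mul (by positivity), mul_comm]
      apply ENNReal.ofReal_le_ofReal
      gcongr
      have e : c₂ * b ^ (-(2 * s)) = (b / (2 * L)) ^ (-(2 * s)) := by
        rw [Real.div_rpow hb.le (by positivity), Real.rpow_neg (x := 2 * L) (by positivity)]
        field_simp
        rfl
      rw [e]
      exact Real.rpow_le_rpow_of_nonpos hbL hx.1 (by linarith)
    have step := hardy_step hs hL hLs hε hb hf
    rw [← hA] at step
    have tot : A ≤ ENNReal.ofReal (max c₁ c₂) * R + ENNReal.ofReal (1 / 2) * A := by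
      refine split.trans ((add_le_add_left step _).trans ?_)
      rw [add_right_comm, mul_add (ENNReal.ofReal (max c₁ c₂))]
      rw [← mul_assoc (ENNReal.ofReal (max c₁ c₂)),
        ← ENNReal.ofReal_mul (le_max_of_le_right (by positivity))]
      gcongr
      · exact le_max_left _ _
      · exact le_max_right _ _
    have half : A = ENNReal.ofReal (1 / 2) * A + ENNReal.ofReal (1 / 2) * A := by
      rw [← add_mul, ← ENNReal.ofReal_add (by norm_num) (by norm_num)]; norm_num
    have hh : ENNReal.ofReal (1 / 2) * A ≤ ENNReal.ofReal (max c₁ c₂) * R := by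
      nth_rewrite 1 [half] at tot
      exact (ENNReal.add_le_add_iff_right
        (ENNReal.mul_ne_top ENNReal.ofReal_ne_top hAfin)).1 tot
    calc A = 2 * (ENNReal.ofReal (1 / 2) * A) := by rw [two_mul]; exact half
      _ ≤ 2 * (ENNReal.ofReal (max c₁ c₂) * R) := by gcongr
      _ = _ := by rw [← mul_assoc, ENNReal.ofReal_mul (p := 2) (by norm_num)]; norm_num
  -- The bound does not depend on ε, so monotone convergence along ε = 1/(n+1) removes the cut-off.
  have hun : Ioo 0 b = ⋃ n : ℕ, Ioo (1 / ((n : ℝ) + 1)) b := by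
    ext x
    simp only [mem_Ioo, mem_iUnion, exists_and_right, and_congr_left_iff]
    exact fun _ => ⟨fun h => exists_nat_one_div_lt h,
      fun ⟨n, hn⟩ => lt_trans (by positivity) hn⟩
  rw [hun, setLIntegral_iUnion_of_directed]
  · refine iSup_le fun n => ?_
    exact hε _ (by positivity)
  · refine Monotone.directed_le fun n m hnm => Ioo_subset_Ioo_left ?_
    apply one_div_le_one_div_of_le (by positivity)
    exact_mod_cast Nat.succ_le_succ hnm

theorem lineEnergy_comp (s : ℝ) {φ : ℝ → ℝ} (hφ : MeasurePreserving φ)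
    (he : MeasurableEmbedding φ) (hi : Isometry φ) (S : Set ℝ) (f : ℝ → ℝ) :
    lineEnergy s (φ ⁻¹' S) (f ∘ φ) = lineEnergy s S f := by
  unfold lineEnergy
  rw [← hφ.setLIntegral_comp_preimage_emb he (fun x => ∫⁻ y in S, _)]
  refine lintegral_congr fun x => ?_
  rw [← hφ.setLIntegral_comp_preimage_emb he
    (fun y => ENNReal.ofReal ((f (φ x) - f y) ^ 2 / |φ x - y| ^ (1 + 2 * s)))]
  refine lintegral_congr fun y => ?_
  have := hi.dist_eq x y
  rw [Real.dist_eq, Real.dist_eq] at this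
  simp only [Function.comp, this]

theorem hardy_Ioo {s : ℝ} (hs : 0 < s) (hs1 : s < 1 / 2) : ∃ C : ℝ≥0, ∀ a b : ℝ, a < b →
    ∀ f : ℝ → ℝ, Measurable f → ∫⁻ x in Ioo a b, ENNReal.ofReal (f x ^ 2) ≠ ∞ →
    ∫⁻ x in Ioo a b, ENNReal.ofReal (f x ^ 2 * (x - a) ^ (-(2 * s))) ≤
      C * (lineEnergy s (Ioo a b) f +
        ENNReal.ofReal ((b - a) ^ (-(2 * s))) * ∫⁻ x in Ioo a b, ENNReal.ofReal (f x ^ 2)) := by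
  obtain ⟨C, hC⟩ := hardy_Ioo_zero hs hs1
  refine ⟨C, fun a b hab f hf hfin => ?_⟩
  have hφ : MeasurePreserving fun x : ℝ => x + a := measurePreserving_add_right volume a
  have he : MeasurableEmbedding fun x : ℝ => x + a := measurableEmbedding_addRight a
  have hi : Isometry fun x : ℝ => x + a := isometry_add_right a
  have hpre : (fun x : ℝ => x + a) ⁻¹' Ioo a b = Ioo 0 (b - a) := by simp
  have h := hC (b - a) (sub_pos.2 hab) (fun x => f (x + a)) (by fun_prop)
  have e := lineEnergy_comp s hφ he hi (Ioo a b) f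
  rw [← hφ.setLIntegral_comp_preimage_emb he] at hfin ⊢
  rw [← hφ.setLIntegral_comp_preimage_emb he (fun x => ENNReal.ofReal (f x ^ 2)), ← e]
  rw [hpre] at hfin ⊢
  simpa [Function.comp_def] using h hfin

/-- With mean zero the cross term drops from ∫ (f x - f y)² dy, which is therefore at least (b - a)
f(x)². The kernel is inserted using |x - y| ≤ b - a. The power of b - a matches the remainder in the
Hardy inequality. -/
theorem poincare_Ioo {s : ℝ} (hs : 0 < s) {a b : ℝ} (hab : a < b) {f : ℝ → ℝ} (hf : Measurable f)
    (hfin : ∫⁻ x in Ioo a b, ENNReal.ofReal (f x ^ 2) ≠ ∞) (h0 : ∫ x in Ioo a b, f x = 0) :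
    ENNReal.ofReal ((b - a) ^ (-(2 * s))) * ∫⁻ x in Ioo a b, ENNReal.ofReal (f x ^ 2) ≤
      lineEnergy s (Ioo a b) f := by
  have hba : 0 < b - a := sub_pos.2 hab
  have hsq : IntegrableOn (fun x => f x ^ 2) (Ioo a b) := by
    refine ⟨by fun_prop, ?_⟩
    rw [hasFiniteIntegral_iff_ofReal (ae_of_all _ fun x => sq_nonneg _)]
    exact hfin.lt_top
  have hint : IntegrableOn f (Ioo a b) := by
    have := (memLp_two_iff_integrable_sq (μ := volume.restrict (Ioo a b))
      hf.aestronglyMeasurable).2 hsq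
    exact this.integrable (by norm_num)
  unfold lineEnergy
  rw [← lintegral_const_mul _ (by fun_prop)]
  refine setLIntegral_mono' measurableSet_Ioo fun x hx => ?_
  have h1 : (b - a) * f x ^ 2 ≤ ∫ y in Ioo a b, (f x - f y) ^ 2 := by
    have e : ∀ y, (f x - f y) ^ 2 = f x ^ 2 - 2 * f x * f y + f y ^ 2 := fun y => by ring
    simp_rw [e]
    rw [integral_add (f := fun y => f x ^ 2 - 2 * f x * f y)
      ((integrable_const _).sub (hint.const_mul _)) hsq, integral_sub (integrable_const _) (hint.const_mul _), integral_const_mul, h0]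
    have : 0 ≤ ∫ y in Ioo a b, f y ^ 2 := integral_nonneg fun y => sq_nonneg _
    simp [hab.le]
    linarith
  have hdi : IntegrableOn (fun y => (f x - f y) ^ 2) (Ioo a b) := by
    have e : ∀ y, (f x - f y) ^ 2 = f x ^ 2 - 2 * f x * f y + f y ^ 2 := fun y => by ring
    simp_rw [e]
    exact ((integrable_const _).sub (hint.const_mul _)).add hsq
  have h2 : ENNReal.ofReal ((b - a) * f x ^ 2) ≤
      ∫⁻ y in Ioo a b, ENNReal.ofReal ((f x - f y) ^ 2) := by
    rw [← ofReal_integral_eq_lintegral_ofReal hdi (ae_of_all _ fun y => sq_nonneg _)]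
    exact ENNReal.ofReal_le_ofReal h1
  have e3 : (b - a) ^ (-(2 * s)) * f x ^ 2 =
      (b - a) ^ (-(1 + 2 * s)) * ((b - a) * f x ^ 2) := by
    rw [← mul_assoc, neg_add, Real.rpow_add hba, Real.rpow_neg_one]
    field_simp
  rw [← ENNReal.ofReal_mul (by positivity), e3, ENNReal.ofReal_mul (by positivity)]
  refine (mul_le_mul_right h2 _).trans ?_
  rw [← lintegral_const_mul _ (by fun_prop)]
  refine setLIntegral_mono' measurableSet_Ioo fun y hy => ?_
  rw [← ENNReal.ofReal_mul (by positivity), div_eq_mul_inv, mul_comm]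
  apply ENNReal.ofReal_le_ofReal
  rcases eq_or_ne x y with rfl | hxy
  · simp
  have hp : 0 < |x - y| := abs_pos.2 (sub_ne_zero.2 hxy)
  rw [Real.rpow_neg hba.le]
  gcongr
  rw [abs_le]
  constructor <;> linarith [hx.1, hx.2, hy.1, hy.2]

theorem hardy_Ioo_of_integral_eq_zero {s : ℝ} (hs : 0 < s) (hs1 : s < 1 / 2) :
    ∃ C : ℝ≥0, ∀ a b : ℝ, a < b →
    ∀ f : ℝ → ℝ, Measurable f → ∫⁻ x in Ioo a b, ENNReal.ofReal (f x ^ 2) ≠ ∞ →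
    ∫ x in Ioo a b, f x = 0 →
    ∫⁻ x in Ioo a b, ENNReal.ofReal (f x ^ 2 * (x - a) ^ (-(2 * s))) ≤
      C * lineEnergy s (Ioo a b) f := by
  obtain ⟨C, hC⟩ := hardy_Ioo hs hs1
  refine ⟨C * 2, fun a b hab f hf hfin h0 => (hC a b hab f hf hfin).trans ?_⟩
  rw [ENNReal.coe_mul, mul_assoc]
  gcongr
  rw [ENNReal.coe_ofNat, two_mul (lineEnergy s (Ioo a b) f)]
  exact add_le_add_right (poincare_Ioo hs hab hf hfin h0) _

theorem lineEnergy_mono (s : ℝ) {S T : Set ℝ} (h : S ⊆ T) (f : ℝ → ℝ) :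
    lineEnergy s S f ≤ lineEnergy s T f :=
  (lintegral_mono_set h).trans (lintegral_mono fun _ => lintegral_mono_set h)

/-- Apply the bounded case on (a, a + n + 1): the remainder carries (n + 1)^{-2s} and vanishes in
the limit, so no mean condition is needed. -/
theorem hardy_Ioi {s : ℝ} (hs : 0 < s) (hs1 : s < 1 / 2) :
    ∃ C : ℝ≥0, ∀ a : ℝ,
    ∀ f : ℝ → ℝ, Measurable f → ∫⁻ x in Ioi a, ENNReal.ofReal (f x ^ 2) ≠ ∞ →
    ∫⁻ x in Ioi a, ENNReal.ofReal (f x ^ 2 * (x - a) ^ (-(2 * s))) ≤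
      C * lineEnergy s (Ioi a) f := by
  obtain ⟨C, hC⟩ := hardy_Ioo hs hs1
  refine ⟨C, fun a f hf hfin => ?_⟩
  set N := ∫⁻ x in Ioi a, ENNReal.ofReal (f x ^ 2)
  have hn : ∀ n : ℕ, ∫⁻ x in Ioo a (a + (n + 1)),
      ENNReal.ofReal (f x ^ 2 * (x - a) ^ (-(2 * s))) ≤
      C * (lineEnergy s (Ioi a) f + ENNReal.ofReal ((n + 1 : ℝ) ^ (-(2 * s))) * N) := by
    intro n
    have hle : ∫⁻ x in Ioo a (a + (n + 1)), ENNReal.ofReal (f x ^ 2) ≤ N :=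
      lintegral_mono_set Ioo_subset_Ioi_self
    refine (hC a (a + (n + 1)) (by linarith [n.cast_nonneg (α := ℝ)]) f hf
      (ne_top_of_le_ne_top hfin hle)).trans ?_
    rw [add_sub_cancel_left]
    gcongr
    exact lineEnergy_mono s Ioo_subset_Ioi_self f
  have hmono : Monotone fun n : ℕ => Ioo a (a + (n + 1)) := fun n m hnm =>
    Ioo_subset_Ioo_right (by
      have : (n : ℝ) ≤ m := by exact_mod_cast hnm
      linarith)
  have hun : Ioi a = ⋃ n : ℕ, Ioo a (a + (n + 1)) := by
    ext x
    simp only [mem_Ioi, mem_iUnion, mem_Ioo, exists_and_left]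
    refine ⟨fun h => ⟨h, ?_⟩, fun h => h.1⟩
    obtain ⟨n, hn⟩ := exists_nat_gt (x - a)
    exact ⟨n, by linarith⟩
  have hlim : Filter.Tendsto (fun n : ℕ => C * (lineEnergy s (Ioi a) f +
      ENNReal.ofReal ((n + 1 : ℝ) ^ (-(2 * s))) * N)) Filter.atTop
      (nhds (C * (lineEnergy s (Ioi a) f + 0 * N))) := by
    refine ENNReal.Tendsto.const_mul ?_ (Or.inr ENNReal.coe_ne_top)
    refine Filter.Tendsto.const_add _ (ENNReal.Tendsto.mul_const ?_ (Or.inr hfin))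
    have h1 : Filter.Tendsto (fun n : ℕ => (n : ℝ) + 1) Filter.atTop Filter.atTop :=
      Filter.tendsto_atTop_add_const_right _ _ tendsto_natCast_atTop_atTop
    have := ENNReal.tendsto_ofReal
      ((tendsto_rpow_neg_atTop (y := 2 * s) (by linarith)).comp h1)
    simpa using this
  rw [zero_mul, add_zero] at hlim
  have hlim2 : Filter.Tendsto (fun n : ℕ => ∫⁻ x in Ioo a (a + (n + 1)),
      ENNReal.ofReal (f x ^ 2 * (x - a) ^ (-(2 * s)))) Filter.atTop
      (nhds (∫⁻ x in Ioi a, ENNReal.ofReal (f x ^ 2 * (x - a) ^ (-(2 * s))))) := by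
    have e : ∫⁻ x in Ioi a, ENNReal.ofReal (f x ^ 2 * (x - a) ^ (-(2 * s))) =
        ⨆ n : ℕ, ∫⁻ x in Ioo a (a + (n + 1)),
          ENNReal.ofReal (f x ^ 2 * (x - a) ^ (-(2 * s))) := by
      conv_lhs => rw [hun]
      exact setLIntegral_iUnion_of_directed _ hmono.directed_le
    rw [e]
    exact tendsto_atTop_iSup fun n m hnm => lintegral_mono_set (hmono hnm)
  exact le_of_tendsto_of_tendsto' hlim2 hlim hn

/-! ### Kernel tails and truncation to {v > 0} on the line -/

/-- The mass at `x` of the kernel of order `s` over `T`. -/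
noncomputable def lineTail (s : ℝ) (T : Set ℝ) (x : ℝ) : ℝ≥0∞ :=
  ∫⁻ y in T, ENNReal.ofReal (1 / |x - y| ^ (1 + 2 * s))

theorem measurable_lineTail (s : ℝ) (T : Set ℝ) : Measurable (lineTail s T) := by
  have : Measurable fun p : ℝ × ℝ => ENNReal.ofReal (1 / |p.1 - p.2| ^ (1 + 2 * s)) := by
    fun_prop
  exact this.lintegral_prod_right'

/-- The integral of t^{-1-2s} over (x - a, ∞). This identifies the Hardy weight with the kernel mass
beyond an endpoint. -/
theorem lineTail_Iic {s : ℝ} (hs : 0 < s) {a x : ℝ} (hx : a < x) :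
    lineTail s (Iic a) x = ENNReal.ofReal ((x - a) ^ (-(2 * s)) / (2 * s)) := by
  have hφ : MeasurePreserving fun y : ℝ => x - y := Measure.measurePreserving_sub_left volume x
  have he : MeasurableEmbedding fun y : ℝ => x - y := measurableEmbedding_subLeft x
  have hxa : 0 < x - a := sub_pos.2 hx
  have hpre : (fun y : ℝ => x - y) ⁻¹' Ici (x - a) = Iic a := by ext; simp
  have h1 : lineTail s (Iic a) x =
      ∫⁻ t in Ici (x - a), ENNReal.ofReal (1 / |t| ^ (1 + 2 * s)) := by
    rw [← hφ.setLIntegral_comp_preimage_emb he, hpre]; rfl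
  have hexp : -(1 + 2 * s) < -1 := by linarith
  rw [h1, setLIntegral_congr Ioi_ae_eq_Ici.symm]
  have h2 : ∫⁻ t in Ioi (x - a), ENNReal.ofReal (1 / |t| ^ (1 + 2 * s)) =
      ∫⁻ t in Ioi (x - a), ENNReal.ofReal (t ^ (-(1 + 2 * s))) := by
    refine setLIntegral_congr_fun measurableSet_Ioi fun t ht => ?_
    have ht0 : 0 < t := hxa.trans ht
    simp only [abs_of_pos ht0, Real.rpow_neg ht0.le, one_div]
  rw [h2, ← ofReal_integral_eq_lintegral_ofReal (integrableOn_Ioi_rpow_of_lt hexp hxa),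
    integral_Ioi_rpow_of_lt hexp hxa]
  · congr 1
    rw [show -(1 + 2 * s) + 1 = -(2 * s) by ring, neg_div_neg_eq]
  · filter_upwards [ae_restrict_mem measurableSet_Ioi] with t ht
    exact Real.rpow_nonneg (hxa.trans ht).le _

theorem _root_.IsOpen.eq_Ioo_csInf_csSup {I : Set ℝ} (ho : IsOpen I) (hc : IsConnected I)
    (hb : BddBelow I) (ha : BddAbove I) : I = Ioo (sInf I) (sSup I) := by
  refine Subset.antisymm ?_ (hc.Ioo_csInf_csSup_subset hb ha)
  have := interior_mono (subset_Icc_csInf_csSup hb ha)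
  rwa [ho.interior_eq, interior_Icc] at this

theorem _root_.IsOpen.eq_Ioi_csInf {I : Set ℝ} (ho : IsOpen I) (hc : IsConnected I)
    (hb : BddBelow I) (ha : ¬ BddAbove I) : I = Ioi (sInf I) := by
  refine Subset.antisymm ?_ (hc.isPreconnected.Ioi_csInf_subset hb ha)
  have : I ⊆ Ici (sInf I) := fun x hx => csInf_le hb hx
  have := interior_mono this
  rwa [ho.interior_eq, interior_Ici] at this

/-- The Hardy inequality at the lower end of an open interval `I`. -/
theorem hardy_lower {s : ℝ} (hs : 0 < s) (hs1 : s < 1 / 2) :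
    ∃ C : ℝ≥0, ∀ I : Set ℝ, IsOpen I → IsConnected I → BddBelow I →
    ∀ f : ℝ → ℝ, Measurable f → ∫⁻ x, ENNReal.ofReal (f x ^ 2) ≠ ∞ →
    (BddAbove I → ∫ x in I, f x = 0) →
    ∫⁻ x in I, ENNReal.ofReal (f x ^ 2) * lineTail s (Iic (sInf I)) x ≤ C * lineEnergy s I f := by
  obtain ⟨C₁, hC₁⟩ := hardy_Ioo_of_integral_eq_zero hs hs1
  obtain ⟨C₂, hC₂⟩ := hardy_Ioi hs hs1
  refine ⟨Real.toNNReal (1 / (2 * s)) * (C₁ + C₂), fun I ho hc hb f hf hfin h0 => ?_⟩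
  have hlow : ∀ x ∈ I, sInf I < x := by
    intro x hx
    have : I ⊆ Ici (sInf I) := fun x hx => csInf_le hb hx
    have := interior_mono this
    rw [ho.interior_eq, interior_Ici] at this
    exact this hx
  have h1 : ∫⁻ x in I, ENNReal.ofReal (f x ^ 2) * lineTail s (Iic (sInf I)) x =
      ENNReal.ofReal (1 / (2 * s)) *
        ∫⁻ x in I, ENNReal.ofReal (f x ^ 2 * (x - sInf I) ^ (-(2 * s))) := by
    rw [← lintegral_const_mul _ (by fun_prop)]
    refine setLIntegral_congr_fun ho.measurableSet fun x hx => ?_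
    rw [lineTail_Iic hs (hlow x hx), ← ENNReal.ofReal_mul (by positivity),
      ← ENNReal.ofReal_mul (by positivity)]
    congr 1; ring
  rw [h1, ENNReal.coe_mul, mul_assoc]
  refine mul_le_mul_right ?_ _
  have hle : ∀ S : Set ℝ, ∫⁻ x in S, ENNReal.ofReal (f x ^ 2) ≠ ∞ := fun S =>
    ne_top_of_le_ne_top hfin (setLIntegral_le_lintegral _ _)
  -- A bounded interval uses the mean-zero inequality; a half-line needs no such condition.
  by_cases ha : BddAbove I
  · have e := ho.eq_Ioo_csInf_csSup hc hb ha
    have hlt : sInf I < sSup I := by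
      obtain ⟨x, hx⟩ := hc.nonempty
      rw [e] at hx; exact hx.1.trans hx.2
    have := hC₁ _ _ hlt f hf (hle _) (by rw [← e]; exact h0 ha)
    rw [← e] at this
    refine this.trans ?_
    gcongr
    exact_mod_cast le_self_add
  · have e := ho.eq_Ioi_csInf hc hb ha
    have := hC₂ (sInf I) f hf (hle _)
    rw [← e] at this
    refine this.trans ?_
    gcongr
    exact_mod_cast le_add_self

/-- The reflection x ↦ -x exchanges the two ends and preserves the energy. -/
theorem hardy_upper {s : ℝ} (hs : 0 < s) (hs1 : s < 1 / 2) :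
    ∃ C : ℝ≥0, ∀ I : Set ℝ, IsOpen I → IsConnected I → BddAbove I →
    ∀ f : ℝ → ℝ, Measurable f → ∫⁻ x, ENNReal.ofReal (f x ^ 2) ≠ ∞ →
    (BddBelow I → ∫ x in I, f x = 0) →
    ∫⁻ x in I, ENNReal.ofReal (f x ^ 2) * lineTail s (Ici (sSup I)) x ≤ C * lineEnergy s I f := by
  obtain ⟨C, hC⟩ := hardy_lower hs hs1
  refine ⟨C, fun I ho hc ha f hf hfin h0 => ?_⟩
  have hφ : MeasurePreserving (Neg.neg : ℝ → ℝ) := Measure.measurePreserving_neg volume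
  have he : MeasurableEmbedding (Neg.neg : ℝ → ℝ) := (MeasurableEquiv.neg ℝ).measurableEmbedding
  have hi : Isometry (Neg.neg : ℝ → ℝ) := isometry_neg
  have h := hC (Neg.neg ⁻¹' I) (ho.preimage continuous_neg)
    (by rw [neg_preimage, ← image_neg_eq_neg]; exact hc.image _ continuous_neg.continuousOn)
    (by rw [neg_preimage]; exact ha.neg) (f ∘ Neg.neg) (hf.comp measurable_neg)
    (by
      have := hφ.lintegral_comp_emb he (fun x => ENNReal.ofReal (f x ^ 2))
      simpa [Function.comp, this] using hfin)
    (fun hb => by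
      have := hφ.setIntegral_preimage_emb he f I
      simp only [Function.comp, this]
      apply h0
      rw [neg_preimage] at hb
      simpa using hb)
  rw [lineEnergy_comp s hφ he hi] at h
  refine le_trans (le_of_eq ?_) h
  rw [← hφ.setLIntegral_comp_preimage_emb he]
  refine lintegral_congr fun x => ?_
  have e : (Neg.neg : ℝ → ℝ) ⁻¹' (Ici (sSup I)) = Iic (sInf (Neg.neg ⁻¹' I)) := by
    rw [neg_preimage, neg_preimage, Real.sInf_neg]
    ext; simp
  simp only [Function.comp]
  congr 1
  unfold lineTail
  rw [← hφ.setLIntegral_comp_preimage_emb he, e]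
  refine lintegral_congr fun y => ?_
  rw [← abs_neg]; congr 4; ring

/-- Adding a limit point to a connected set leaves it connected, so a component is relatively closed
in `O`. Hence an endpoint of a component of {v > 0} cannot lie in {v > 0}. -/
theorem connectedComponentIn_maximal {O : Set ℝ} {c a : ℝ}
    (ha : a ∈ closure (connectedComponentIn O c)) (hc : c ∈ O) (haO : a ∈ O) :
    a ∈ connectedComponentIn O c := by
  have hp : IsPreconnected (insert a (connectedComponentIn O c)) :=
    isPreconnected_connectedComponentIn.subset_closure (subset_insert _ _)
      (insert_subset ha subset_closure)
  exact hp.subset_connectedComponentIn (mem_insert_of_mem _ (mem_connectedComponentIn hc))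
    (insert_subset haO (connectedComponentIn_subset _ _)) (mem_insert _ _)

/-- If a continuous function `v` has derivative `g` in the integral sense, `g` has mean zero on the
bounded components of `{v > 0}`. -/
theorem setIntegral_component_eq_zero {v g : ℝ → ℝ} (hv : Continuous v)
    (hvg : ∀ a b, v b - v a = ∫ t in a..b, g t) {c : ℝ} (hc : 0 < v c)
    (hb : BddBelow (connectedComponentIn {x | 0 < v x} c))
    (ha : BddAbove (connectedComponentIn {x | 0 < v x} c)) :
    ∫ x in connectedComponentIn {x | 0 < v x} c, g x = 0 := by
  set O := {x | 0 < v x}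
  have hO : IsOpen O := isOpen_lt continuous_const hv
  set I := connectedComponentIn O c
  have hcI : c ∈ I := mem_connectedComponentIn hc
  have hI : IsOpen I := hO.connectedComponentIn
  have hIc : IsConnected I := isConnected_connectedComponentIn_iff.2 hc
  have e := hI.eq_Ioo_csInf_csSup hIc hb ha
  have hlt : sInf I < sSup I := by rw [e] at hcI; exact hcI.1.trans hcI.2
  -- Maximality of the component excludes v p > 0, and continuity gives v p ≥ 0.
  have zero : ∀ p ∈ closure I, p ∉ I → v p = 0 := by
    intro p hp hpI
    refine le_antisymm (not_lt.1 fun h => hpI (connectedComponentIn_maximal hp hc h)) ?_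
    have hsub : I ⊆ {x | 0 ≤ v x} := fun x hx =>
      le_of_lt (show 0 < v x from connectedComponentIn_subset O c hx)
    exact closure_minimal hsub (isClosed_le continuous_const hv) hp
  have z1 : v (sInf I) = 0 := zero _ (csInf_mem_closure hIc.nonempty hb) (by
    rw [e]; simp [csInf_Ioo hlt])
  have z2 : v (sSup I) = 0 := zero _ (csSup_mem_closure hIc.nonempty ha) (by
    rw [e]; simp [csSup_Ioo hlt])
  have := hvg (sInf I) (sSup I)
  rw [z1, z2, sub_zero, intervalIntegral.integral_of_le hlt.le, integral_Ioc_eq_integral_Ioo,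
    ← e] at this
  exact this.symm

/-- The Hardy inequality on one component of `{v > 0}`. -/
theorem hardy_component {s : ℝ} (hs : 0 < s) (hs1 : s < 1 / 2) :
    ∃ C : ℝ≥0, ∀ v g : ℝ → ℝ, Continuous v → Measurable g →
    ∫⁻ x, ENNReal.ofReal (g x ^ 2) ≠ ∞ → (∀ a b, v b - v a = ∫ t in a..b, g t) →
    ∀ c ∈ {x | 0 < v x}, ∫⁻ x in connectedComponentIn {x | 0 < v x} c,
      ENNReal.ofReal (g x ^ 2) * lineTail s {x | 0 < v x}ᶜ x ≤
        C * lineEnergy s (connectedComponentIn {x | 0 < v x} c) g := by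
  obtain ⟨C₁, hC₁⟩ := hardy_lower hs hs1
  obtain ⟨C₂, hC₂⟩ := hardy_upper hs hs1
  refine ⟨C₁ + C₂, fun v g hv hg hfin hvg c hc => ?_⟩
  have hO : IsOpen {x | 0 < v x} := isOpen_lt continuous_const hv
  set O := {x | 0 < v x}
  set I := connectedComponentIn O c
  have hI : IsOpen I := hO.connectedComponentIn
  have hIc : IsConnected I := isConnected_connectedComponentIn_iff.2 hc
  -- The boundedness clause makes the set empty when I has no lower end, so the default value of
  -- `sInf` never enters; likewise for `T₂`.
  set T₁ : Set ℝ := {y | BddBelow I ∧ y ≤ sInf I}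
  set T₂ : Set ℝ := {y | BddAbove I ∧ sSup I ≤ y}
  -- A point of the complement with points of I on both sides would belong to I, by connectedness.
  have hsub : Oᶜ ⊆ T₁ ∪ T₂ := by
    intro y hy
    have hyI : y ∉ I := fun h => hy (connectedComponentIn_subset O c h)
    by_contra hcon
    simp only [T₁, T₂, mem_union, mem_ofPred_eq, not_or, not_and, not_le] at hcon
    obtain ⟨p, hp, hpy⟩ : ∃ p ∈ I, p < y := by
      by_cases hb : BddBelow I
      · exact exists_lt_of_csInf_lt hIc.nonempty (hcon.1 hb)
      · by_contra! h
        exact hb ⟨y, fun p hp => h p hp⟩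
    obtain ⟨q, hq, hqy⟩ : ∃ q ∈ I, y < q := by
      by_cases ha : BddAbove I
      · exact exists_lt_of_lt_csSup hIc.nonempty (hcon.2 ha)
      · by_contra! h
        exact ha ⟨y, fun p hp => h p hp⟩
    exact hyI (hIc.isPreconnected.Icc_subset hp hq ⟨hpy.le, hqy.le⟩)
  have htail : ∀ x, lineTail s Oᶜ x ≤ lineTail s T₁ x + lineTail s T₂ x := fun x =>
    (lintegral_mono_set hsub).trans (lintegral_union_le _ _ _)
  have m : ∀ T, Measurable fun x => ENNReal.ofReal (g x ^ 2) * lineTail s T x := fun T => by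
    have := measurable_lineTail s T
    fun_prop
  have h0 := fun hb ha => setIntegral_component_eq_zero hv hvg hc hb ha
  have h1 : ∫⁻ x in I, ENNReal.ofReal (g x ^ 2) * lineTail s T₁ x ≤ C₁ * lineEnergy s I g := by
    by_cases hb : BddBelow I
    · have : T₁ = Iic (sInf I) := by ext; simp [T₁, hb]
      rw [this]
      exact hC₁ I hI hIc hb g hg hfin (h0 hb)
    · have : T₁ = ∅ := by ext; simp [T₁, hb]
      simp [this, lineTail]
  have h2 : ∫⁻ x in I, ENNReal.ofReal (g x ^ 2) * lineTail s T₂ x ≤ C₂ * lineEnergy s I g := by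
    by_cases ha : BddAbove I
    · have : T₂ = Ici (sSup I) := by ext; simp [T₂, ha]
      rw [this]
      exact hC₂ I hI hIc ha g hg hfin (fun hb => h0 hb ha)
    · have : T₂ = ∅ := by ext; simp [T₂, ha]
      simp [this, lineTail]
  calc _ ≤ ∫⁻ x in I, (ENNReal.ofReal (g x ^ 2) * lineTail s T₁ x +
        ENNReal.ofReal (g x ^ 2) * lineTail s T₂ x) := by
        refine lintegral_mono fun x => ?_
        rw [← mul_add]
        exact mul_le_mul_right (htail x) _
    _ ≤ _ := by
        rw [lintegral_add_left (m _), ENNReal.coe_add, add_mul]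
        exact add_le_add h1 h2

/-- The components of an open set of reals form a countable family. -/
theorem countable_components {O : Set ℝ} (hO : IsOpen O) :
    (connectedComponentIn O '' O).Countable := by
  refine PairwiseDisjoint.countable_of_isOpen (a := connectedComponentIn O '' O) (s := id) ?_ ?_ ?_
  · rintro _ ⟨x, hx, rfl⟩ _ ⟨y, hy, rfl⟩ hne
    rw [Function.onFun, id, id, Set.disjoint_left]
    exact fun z hz hz' => hne
      ((connectedComponentIn_eq hz).trans (connectedComponentIn_eq hz').symm)
  · rintro _ ⟨x, hx, rfl⟩
    exact hO.connectedComponentIn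
  · rintro _ ⟨x, hx, rfl⟩
    exact ⟨x, mem_connectedComponentIn hx⟩

/-- The constant is the same for all components, and the strips I × ℝ over distinct components are
disjoint, so the componentwise bounds sum to at most the full energy. -/
theorem hardy_positive_set {s : ℝ} (hs : 0 < s) (hs1 : s < 1 / 2) :
    ∃ C : ℝ≥0, ∀ v g : ℝ → ℝ, Continuous v → Measurable g →
    ∫⁻ x, ENNReal.ofReal (g x ^ 2) ≠ ∞ → (∀ a b, v b - v a = ∫ t in a..b, g t) →
    ∫⁻ x in {x | 0 < v x}, ENNReal.ofReal (g x ^ 2) * lineTail s {x | 0 < v x}ᶜ x ≤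
      C * lineEnergy s univ g := by
  obtain ⟨C, hC⟩ := hardy_component hs hs1
  refine ⟨C, fun v g hv hg hfin hvg => ?_⟩
  have hO : IsOpen {x | 0 < v x} := isOpen_lt continuous_const hv
  have hcomp := hC v g hv hg hfin hvg
  set O := {x | 0 < v x}
  set 𝒞 := connectedComponentIn O '' O
  have hcount : 𝒞.Countable := countable_components hO
  have hdisj : 𝒞.PairwiseDisjoint id := by
    rintro _ ⟨x, hx, rfl⟩ _ ⟨y, hy, rfl⟩ hne
    rw [Function.onFun, id, id, Set.disjoint_left]
    exact fun z hz hz' => hne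
      ((connectedComponentIn_eq hz).trans (connectedComponentIn_eq hz').symm)
  have hmeas : ∀ I ∈ 𝒞, MeasurableSet (id I) := by
    rintro _ ⟨x, hx, rfl⟩
    exact hO.connectedComponentIn.measurableSet
  have hun : O = ⋃ I ∈ 𝒞, id I := by
    ext x
    simp only [mem_iUnion]
    constructor
    · exact fun hx => ⟨_, ⟨x, hx, rfl⟩, mem_connectedComponentIn hx⟩
    · rintro ⟨_, ⟨y, hy, rfl⟩, hx⟩
      exact connectedComponentIn_subset _ _ hx
  have e : ∀ F : ℝ → ℝ≥0∞, ∫⁻ x in O, F x = ∑' I : 𝒞, ∫⁻ x in (I : Set ℝ), F x := by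
    intro F
    conv_lhs => rw [hun]
    exact lintegral_biUnion hcount hmeas hdisj F
  calc _ = ∑' I : 𝒞, ∫⁻ x in (I : Set ℝ), ENNReal.ofReal (g x ^ 2) * lineTail s Oᶜ x := e _
    _ ≤ ∑' I : 𝒞, ∫⁻ x in (I : Set ℝ), C * ∫⁻ y,
          ENNReal.ofReal ((g x - g y) ^ 2 / |x - y| ^ (1 + 2 * s)) := by
        refine ENNReal.tsum_le_tsum ?_
        rintro ⟨_, ⟨c, hc, rfl⟩⟩
        refine (hcomp c hc).trans ?_
        rw [lintegral_const_mul _ (measurable_lineKernel hg s).lintegral_prod_right']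
        gcongr
        exact lintegral_mono fun x => setLIntegral_le_lintegral _ _
    _ = ∫⁻ x in O, C * ∫⁻ y,
          ENNReal.ofReal ((g x - g y) ^ 2 / |x - y| ^ (1 + 2 * s)) := (e _).symm
    _ ≤ _ := by
        rw [lintegral_const_mul _ (measurable_lineKernel hg s).lintegral_prod_right']
        simp only [lineEnergy, Measure.restrict_univ]
        gcongr
        exact Measure.restrict_le_self

/-- Truncating `v'` to `{v > 0}` is bounded for the Gagliardo energy on the line. -/
theorem lineEnergy_indicator_le {s : ℝ} (hs : 0 < s) (hs1 : s < 1 / 2) :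
    ∃ C : ℝ≥0, ∀ v g : ℝ → ℝ, Continuous v → Measurable g →
    ∫⁻ x, ENNReal.ofReal (g x ^ 2) ≠ ∞ → (∀ a b, v b - v a = ∫ t in a..b, g t) →
    lineEnergy s univ ({x | 0 < v x}.indicator g) ≤ C * lineEnergy s univ g := by
  obtain ⟨C, hC⟩ := hardy_positive_set hs hs1
  refine ⟨1 + 2 * C, fun v g hv hg hfin hvg => ?_⟩
  have hO : IsOpen {x | 0 < v x} := isOpen_lt continuous_const hv
  have hardy := hC v g hv hg hfin hvg
  set O := {x | 0 < v x}
  -- The contribution of mixed pairs x ∈ O, y ∉ O, where the truncated difference is g x alone. The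
  -- opposite pairs contribute the same by symmetry, whence the factor 2.
  set F : ℝ → ℝ → ℝ≥0∞ := fun x y => O.indicator (fun x => ENNReal.ofReal (g x ^ 2) *
    Oᶜ.indicator (fun y => ENNReal.ofReal (1 / |x - y| ^ (1 + 2 * s))) y) x
  have hF : Measurable (Function.uncurry F) := by
    have : Function.uncurry F = (O ×ˢ Oᶜ).indicator fun p : ℝ × ℝ =>
        ENNReal.ofReal (g p.1 ^ 2) * ENNReal.ofReal (1 / |p.1 - p.2| ^ (1 + 2 * s)) := by
      ext ⟨x, y⟩
      by_cases hx : x ∈ O <;> by_cases hy : y ∈ O <;> simp [F, hx, hy]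
    rw [this]
    exact Measurable.indicator (by fun_prop) (hO.measurableSet.prod hO.measurableSet.compl)
  have hFle : ∫⁻ x, ∫⁻ y, F x y ≤ C * lineEnergy s univ g := by
    refine le_trans (le_of_eq ?_) hardy
    rw [← lintegral_indicator hO.measurableSet]
    refine lintegral_congr fun x => ?_
    by_cases hx : x ∈ O
    · simp only [F, indicator_of_mem hx]
      rw [lintegral_const_mul _ (Measurable.indicator (by fun_prop) hO.measurableSet.compl),
        lintegral_indicator hO.measurableSet.compl]
      rfl
    · simp [F, hx]
  have hFswap : ∫⁻ x, ∫⁻ y, F y x = ∫⁻ x, ∫⁻ y, F x y :=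
    lintegral_lintegral_swap (hF.comp measurable_swap).aemeasurable
  have pt : ∀ x y, ENNReal.ofReal ((O.indicator g x - O.indicator g y) ^ 2 /
      |x - y| ^ (1 + 2 * s)) ≤ ENNReal.ofReal ((g x - g y) ^ 2 / |x - y| ^ (1 + 2 * s)) +
        (F x y + F y x) := by
    intro x y
    by_cases hx : x ∈ O <;> by_cases hy : y ∈ O
    · simp [F, hx, hy]
    · simp only [F, hx, hy, indicator_of_mem, indicator_of_notMem, mem_compl_iff,
        not_false_eq_true, sub_zero, add_zero]
      rw [← ENNReal.ofReal_mul (sq_nonneg _), mul_one_div]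
      exact le_add_self
    · simp only [F, hx, hy, indicator_of_mem, indicator_of_notMem, mem_compl_iff,
        not_false_eq_true, zero_sub, zero_add, neg_sq]
      rw [← ENNReal.ofReal_mul (sq_nonneg _), mul_one_div, abs_sub_comm]
      exact le_add_self
    · simp [F, hx, hy]
  have mk := measurable_lineKernel hg s
  have e : ∫⁻ x, ∫⁻ y, (ENNReal.ofReal ((g x - g y) ^ 2 / |x - y| ^ (1 + 2 * s)) +
        (F x y + F y x)) = lineEnergy s univ g + 2 * ∫⁻ x, ∫⁻ y, F x y := by
    have e1 : ∀ x, ∫⁻ y, (ENNReal.ofReal ((g x - g y) ^ 2 / |x - y| ^ (1 + 2 * s)) +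
        (F x y + F y x)) = (∫⁻ y, ENNReal.ofReal ((g x - g y) ^ 2 / |x - y| ^ (1 + 2 * s))) +
        ((∫⁻ y, F x y) + ∫⁻ y, F y x) := fun x => by
      rw [lintegral_add_left (by fun_prop), lintegral_add_left hF.of_uncurry_left]
    simp_rw [e1]
    rw [lintegral_add_left mk.lintegral_prod_right', lintegral_add_left
      (show Measurable fun x => ∫⁻ y, F x y from hF.lintegral_prod_right'), hFswap,
      two_mul (∫⁻ x, ∫⁻ y, F x y)]
    simp [lineEnergy]
  calc lineEnergy s univ (O.indicator g)
      ≤ ∫⁻ x, ∫⁻ y, (ENNReal.ofReal ((g x - g y) ^ 2 / |x - y| ^ (1 + 2 * s)) +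
        (F x y + F y x)) := by
        simp only [lineEnergy, Measure.restrict_univ]
        exact lintegral_mono fun x => lintegral_mono fun y => pt x y
    _ ≤ _ := by
        rw [e]
        push_cast
        rw [add_mul, one_mul, mul_assoc]
        gcongr

/-! ### The chain rule for the positive part on the line -/

theorem _root_.AbsolutelyContinuousOnInterval.max_zero {v : ℝ → ℝ} {a b : ℝ}
    (hv : AbsolutelyContinuousOnInterval v a b) :
    AbsolutelyContinuousOnInterval (fun t => max (v t) 0) a b := by
  rw [absolutelyContinuousOnInterval_iff] at hv ⊢
  intro ε hε
  obtain ⟨δ, hδ, h⟩ := hv ε hε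
  refine ⟨δ, hδ, fun E hE hlt => lt_of_le_of_lt (Finset.sum_le_sum fun i _ => ?_) (h E hE hlt)⟩
  rw [Real.dist_eq, Real.dist_eq]
  exact abs_max_sub_max_le_abs _ _ _

theorem intervalIntegrable_of_locallyIntegrable {g : ℝ → ℝ} (hg : LocallyIntegrable g) (a b : ℝ) :
    IntervalIntegrable g volume a b :=
  intervalIntegrable_iff.mpr ((hg.integrableOn_isCompact isCompact_uIcc).mono_set uIoc_subset_uIcc)

theorem absolutelyContinuousOnInterval_of_integral {v g : ℝ → ℝ} (hg : LocallyIntegrable g)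
    (hvg : ∀ a b, v b - v a = ∫ t in a..b, g t) (a b : ℝ) :
    AbsolutelyContinuousOnInterval v a b := by
  have hi : IntervalIntegrable g volume a b := intervalIntegrable_of_locallyIntegrable hg a b
  have h1 := hi.absolutelyContinuousOnInterval_intervalIntegral (left_mem_uIcc)
  have h2 : AbsolutelyContinuousOnInterval (fun _ : ℝ => v a) a b :=
    (LipschitzWith.const (v a)).lipschitzOnWith.absolutelyContinuousOnInterval
  have e : v = (fun _ : ℝ => v a) + fun x => ∫ t in a..x, g t := by
    ext x
    rw [Pi.add_apply, ← hvg a x]; ring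
  rw [e]
  exact h2.add h1

theorem ae_hasDerivAt_of_integral {v g : ℝ → ℝ} (hg : LocallyIntegrable g)
    (hvg : ∀ a b, v b - v a = ∫ t in a..b, g t) : ∀ᵐ t, HasDerivAt v (g t) t := by
  filter_upwards [LocallyIntegrable.ae_hasDerivAt_integral hg] with t ht
  have e : v = fun x => v 0 + ∫ t in (0 : ℝ)..x, g t := by
    ext x
    rw [← hvg 0 x]; ring
  rw [e]
  exact (ht 0).const_add _

theorem continuous_of_integral {v g : ℝ → ℝ} (hg : LocallyIntegrable g)
    (hvg : ∀ a b, v b - v a = ∫ t in a..b, g t) : Continuous v := by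
  have e : v = fun x => v 0 + ∫ t in (0 : ℝ)..x, g t := by
    ext x
    rw [← hvg 0 x]; ring
  rw [e]
  exact continuous_const.add
    (intervalIntegral.continuous_primitive (fun a b => intervalIntegrable_of_locallyIntegrable hg a b) 0)

/-- The derivative of the positive part, almost everywhere. -/
theorem ae_deriv_max_zero {v g : ℝ → ℝ} (hg : LocallyIntegrable g)
    (hvg : ∀ a b, v b - v a = ∫ t in a..b, g t) :
    ∀ᵐ t, deriv (fun t => max (v t) 0) t = {t | 0 < v t}.indicator g t := by
  have hac := fun n : ℕ => (absolutelyContinuousOnInterval_of_integral hg hvg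
    (-(n : ℝ)) n).max_zero.ae_differentiableAt
  have hv := continuous_of_integral hg hvg
  filter_upwards [ae_hasDerivAt_of_integral hg hvg, ae_all_iff.2 hac] with t ht hd
  obtain ⟨n, hn⟩ := exists_nat_ge |t|
  have hdt := hd n (by
    rw [mem_uIcc]; exact Or.inl (abs_le.1 hn))
  rcases lt_trichotomy (v t) 0 with h | h | h
  · have e : (fun t => max (v t) 0) =ᶠ[nhds t] fun _ => 0 := by
      filter_upwards [hv.continuousAt.eventually_lt_const h] with x hx
      exact max_eq_right hx.le
    rw [e.deriv_eq, deriv_const, indicator_of_notMem]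
    simpa using h.le
  -- At a zero of v the positive part attains its minimum, so its derivative is 0 whatever the value
  -- of g there.
  · have hmin : IsLocalMin (fun t => max (v t) 0) t :=
      Filter.Eventually.of_forall fun x => by simp [h]
    rw [hmin.deriv_eq_zero, indicator_of_notMem]
    simp [h]
  · have e : (fun t => max (v t) 0) =ᶠ[nhds t] v := by
      filter_upwards [hv.continuousAt.eventually_const_lt h] with x hx
      exact max_eq_left hx.le
    rw [e.deriv_eq, ht.deriv, indicator_of_mem]
    exact h

/-- The chain rule for the positive part on the line, in weak form. -/
theorem integral_max_zero_mul_deriv {v g : ℝ → ℝ} (hg : LocallyIntegrable g)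
    (hvg : ∀ a b, v b - v a = ∫ t in a..b, g t) {φ : ℝ → ℝ} (hφ : ContDiff ℝ 1 φ)
    (hc : HasCompactSupport φ) :
    ∫ t, max (v t) 0 * deriv φ t = - ∫ t, {t | 0 < v t}.indicator g t * φ t := by
  -- Enlarging R by one makes φ vanish at both ends, so integration by parts has no boundary terms.
  obtain ⟨R, hR⟩ := hc.isCompact.isBounded.subset_closedBall 0
  have hsupp : tsupport φ ⊆ Ioc (-(R + 1)) (R + 1) := by
    intro x hx
    have := hR hx
    rw [Metric.mem_closedBall, dist_zero_right, Real.norm_eq_abs, abs_le] at this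
    exact ⟨by linarith, by linarith⟩
  have hz : ∀ x ∉ Ioc (-(R + 1)) (R + 1), φ x = 0 := fun x hx =>
    image_eq_zero_of_notMem_tsupport fun h => hx (hsupp h)
  have hzl : φ (-(R + 1)) = 0 := hz _ (by simp)
  have hzr : φ (R + 1) = 0 := by
    apply image_eq_zero_of_notMem_tsupport
    intro h
    have := hR h
    rw [Metric.mem_closedBall, dist_zero_right, Real.norm_eq_abs, abs_le] at this
    linarith
  have h := (absolutelyContinuousOnInterval_of_integral hg hvg (-(R + 1))
    (R + 1)).max_zero.integral_mul_deriv_eq_deriv_mul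
      (hφ.contDiffOn.absolutelyContinuousOnInterval (a := -(R + 1)) (b := R + 1))
  rw [hzl, hzr, mul_zero, mul_zero, sub_zero, zero_sub] at h
  rw [intervalIntegral.integral_eq_integral_of_support_subset,
    intervalIntegral.integral_eq_integral_of_support_subset] at h
  · rw [h]
    congr 1
    refine integral_congr_ae ?_
    filter_upwards [ae_deriv_max_zero hg hvg] with t ht
    rw [ht]
  · intro x hx
    by_contra hcon
    exact hx (by simp [hz x hcon])
  · intro x hx
    apply hsupp
    apply tsupport_deriv_subset (𝕜 := ℝ)
    apply subset_tsupport
    exact right_ne_zero_of_mul hx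

/-! ### Weak directional derivatives as increments -/

/-- All translates of K by σe with 0 < σ ≤ τ lie in one compact set, which bounds the inner
integrals uniformly in σ. This supplies the Fubini hypothesis below. -/
theorem integrable_shift {E : Type*} [NormedAddCommGroup E] [NormedSpace ℝ E] [MeasurableSpace E]
    [BorelSpace E] [FiniteDimensional ℝ E] {μ : Measure E} [μ.IsAddHaarMeasure] {g : E → ℝ}
    (hgm : Measurable g) (hg : LocallyIntegrable g μ) (e : E) (τ : ℝ) {K : Set E}
    (hK : IsCompact K) :
    Integrable (fun p : ℝ × E => g (p.2 + p.1 • e))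
      ((volume.restrict (Ioc 0 τ)).prod (μ.restrict K)) := by
  set K' := (fun p : ℝ × E => p.2 + p.1 • e) '' (Icc 0 τ ×ˢ K)
  have hK' : IsCompact K' := (isCompact_Icc.prod hK).image (by fun_prop)
  have hgK := hg.integrableOn_isCompact hK'
  have hsub : ∀ σ ∈ Ioc 0 τ, K ⊆ (fun x => x + σ • e) ⁻¹' K' := fun σ hσ x hx =>
    ⟨(σ, x), ⟨⟨hσ.1.le, hσ.2⟩, hx⟩, rfl⟩
  have hmp : ∀ σ : ℝ, MeasurePreserving (fun x => x + σ • e) μ μ := fun σ =>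
    measurePreserving_add_right μ _
  have he : ∀ σ : ℝ, MeasurableEmbedding (fun x => x + σ • e) := fun σ =>
    measurableEmbedding_addRight _
  have hm : Measurable fun p : ℝ × E => g (p.2 + p.1 • e) :=
    hgm.comp (Continuous.measurable (by fun_prop))
  have hpre : ∀ σ : ℝ, IntegrableOn (fun x => g (x + σ • e)) ((fun x => x + σ • e) ⁻¹' K') μ :=
    fun σ => ((hmp σ).integrableOn_comp_preimage (he σ)).2 hgK
  rw [integrable_prod_iff hm.aestronglyMeasurable]
  constructor
  · filter_upwards [ae_restrict_mem measurableSet_Ioc] with σ hσ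
    exact (hpre σ).mono_set (hsub σ hσ)
  · refine Integrable.of_bound (C := ∫ x in K', ‖g x‖ ∂μ) ?_ ?_
    · exact (hm.norm.stronglyMeasurable.integral_prod_right').aestronglyMeasurable
    · filter_upwards [ae_restrict_mem measurableSet_Ioc] with σ hσ
      rw [Real.norm_of_nonneg (integral_nonneg fun _ => norm_nonneg _)]
      rw [← (hmp σ).setIntegral_preimage_emb (he σ) (fun x => ‖g x‖)]
      exact setIntegral_mono_set (hpre σ).norm (ae_of_all _ fun _ => norm_nonneg _)
        (hsub σ hσ).eventuallyLE

theorem sub_eq_integral_shift {E : Type*} [NormedAddCommGroup E] [NormedSpace ℝ E] {φ : E → ℝ}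
    (hφ : ContDiff ℝ 1 φ) (e x : E) (τ : ℝ) :
    φ (x - τ • e) - φ x = - ∫ σ in (0 : ℝ)..τ, fderiv ℝ φ (x - σ • e) e := by
  have hd : ∀ σ ∈ uIcc 0 τ, HasDerivAt (fun σ : ℝ => φ (x - σ • e))
      (-(fderiv ℝ φ (x - σ • e) e)) σ := by
    intro σ _
    have h1 : HasDerivAt (fun σ : ℝ => x - σ • e) (-e) σ := by
      simpa using ((hasDerivAt_id σ).smul_const e).const_sub x
    have h2 := ((hφ.differentiable one_ne_zero) (x - σ • e)).hasFDerivAt.comp_hasDerivAt σ h1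
    simpa [Function.comp_def] using h2
  have hc : Continuous fun σ : ℝ => -(fderiv ℝ φ (x - σ • e) e) := by
    have := hφ.continuous_fderiv one_ne_zero
    fun_prop
  have := intervalIntegral.integral_eq_sub_of_hasDerivAt hd (hc.intervalIntegrable _ _)
  rw [← intervalIntegral.integral_neg, this]
  simp

section Shift

variable {E : Type*} [NormedAddCommGroup E] [NormedSpace ℝ E] [MeasurableSpace E]
    [BorelSpace E] [FiniteDimensional ℝ E] {μ : Measure E} [μ.IsAddHaarMeasure] {u g : E → ℝ}
    {e : E}

/-- Move the translation onto φ, write φ(x - τe) - φ(x) as an integral of derivatives of translates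
of φ, apply the weak derivative for each σ, and translate back. -/
theorem integral_shift_mul {φ : E → ℝ} (hum : Measurable u) (hgm : Measurable g)
    (hu : LocallyIntegrable u μ) (hg : LocallyIntegrable g μ)
    (h : ∀ φ : E → ℝ, ContDiff ℝ (⊤ : ℕ∞) φ → HasCompactSupport φ →
      ∫ x, u x * fderiv ℝ φ x e ∂μ = - ∫ x, g x * φ x ∂μ)
    {τ : ℝ} (hτ : 0 ≤ τ) (hφ : ContDiff ℝ (⊤ : ℕ∞) φ) (hc : HasCompactSupport φ) :
    ∫ x, φ x • (u (x + τ • e) - u x) ∂μ =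
      ∫ x, φ x • (∫ σ in (0 : ℝ)..τ, g (x + σ • e)) ∂μ := by
  have hφc := hφ.continuous
  have hφ1 : ContDiff ℝ 1 φ := hφ.of_le (by exact_mod_cast le_top)
  have hdc : Continuous fun x => fderiv ℝ φ x e := by
    have := hφ1.continuous_fderiv one_ne_zero
    fun_prop
  have hdcs : HasCompactSupport fun x => fderiv ℝ φ x e := hc.fderiv_apply ℝ e
  have mp : ∀ σ : ℝ, ∀ F : E → ℝ, ∫ x, F (x + σ • e) ∂μ = ∫ x, F x ∂μ := fun σ F =>
    integral_add_right_eq_self F _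
  have int1 : ∀ ψ : E → ℝ, Continuous ψ → HasCompactSupport ψ →
      Integrable (fun x => u x * ψ x) μ := fun ψ h1 h2 =>
    hu.integrable_smul_right_of_hasCompactSupport h1 h2
  have hφτ : ∀ σ : ℝ, ContDiff ℝ (⊤ : ℕ∞) fun x => φ (x - σ • e) := fun σ =>
    hφ.comp (contDiff_id.sub contDiff_const)
  have hcτ : ∀ σ : ℝ, HasCompactSupport fun x => φ (x - σ • e) := fun σ =>
    hc.comp_homeomorph (Homeomorph.subRight (σ • e))
  have hfd : ∀ (σ : ℝ) x, fderiv ℝ (fun x => φ (x - σ • e)) x e = fderiv ℝ φ (x - σ • e) e :=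
    fun σ x => by simp_rw [sub_eq_add_neg]; rw [fderiv_comp_add_right]
  have L1 : ∫ x, φ x • (u (x + τ • e) - u x) ∂μ = ∫ x, u x * (φ (x - τ • e) - φ x) ∂μ := by
    have i1 : Integrable (fun x => φ x * u (x + τ • e)) μ := by
      have := (int1 _ (hφτ τ).continuous (hcτ τ)).comp_add_right (τ • e)
      simpa [mul_comm] using this
    have i2 : Integrable (fun x => φ x * u x) μ := by
      simpa [mul_comm] using int1 φ hφc hc
    simp_rw [smul_eq_mul, mul_sub]
    rw [integral_sub i1 i2, integral_sub (int1 _ (hφτ τ).continuous (hcτ τ)) (int1 φ hφc hc)]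
    congr 1
    · rw [← mp τ (fun x => u x * φ (x - τ • e))]
      simp [mul_comm]
    · simp [mul_comm]
  obtain ⟨M, hM⟩ := hdcs.exists_bound_of_continuous hdc
  have L2 : ∫ x, u x * (φ (x - τ • e) - φ x) ∂μ =
      - ∫ σ in Ioc 0 τ, ∫ x, u x * fderiv ℝ φ (x - σ • e) e ∂μ := by
    -- The set swept by the support of φ; outside it the integrand vanishes for every σ in (0, τ].
    set K := (fun p : ℝ × E => p.2 + p.1 • e) '' (Icc 0 τ ×ˢ tsupport φ)
    have hK : IsCompact K := (isCompact_Icc.prod hc.isCompact).image (by fun_prop)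
    have hI : Integrable (fun p : ℝ × E => u p.2 * fderiv ℝ φ (p.2 - p.1 • e) e)
        ((volume.restrict (Ioc 0 τ)).prod μ) := by
      have hb : Integrable (fun p : ℝ × E => M * ‖K.indicator u p.2‖)
          ((volume.restrict (Ioc 0 τ)).prod μ) := by
        have : Integrable (fun x => K.indicator u x) μ :=
          (integrable_indicator_iff hK.measurableSet).2 (hu.integrableOn_isCompact hK)
        exact (this.norm.comp_snd _).const_mul M
      refine hb.mono' ?_ ?_
      · refine Measurable.aestronglyMeasurable ((hum.comp measurable_snd).mul ?_)
        exact (hdc.comp (by fun_prop : Continuous fun p : ℝ × E => p.2 - p.1 • e)).measurable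
      · have : ∀ᵐ σ ∂(volume.restrict (Ioc 0 τ)), σ ∈ Ioc 0 τ :=
          ae_restrict_mem measurableSet_Ioc
        have h2 : ∀ᵐ p : ℝ × E ∂((volume.restrict (Ioc 0 τ)).prod μ), p.1 ∈ Ioc 0 τ :=
          Measure.quasiMeasurePreserving_fst.ae this
        filter_upwards [h2] with p hp
        by_cases hpK : p.2 ∈ K
        · rw [indicator_of_mem hpK, norm_mul, mul_comm]
          exact mul_le_mul_of_nonneg_right (hM _) (norm_nonneg _)
        · have hz : fderiv ℝ φ (p.2 - p.1 • e) = 0 := by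
            by_contra hne
            apply hpK
            refine ⟨(p.1, p.2 - p.1 • e), ⟨⟨hp.1.le, hp.2⟩, ?_⟩, by simp⟩
            exact support_fderiv_subset ℝ hne
          simp [hz, hpK]
    rw [← integral_integral_swap (f := fun x σ => u x * fderiv ℝ φ (x - σ • e) e) hI.swap,
      ← integral_neg]
    refine integral_congr_ae (ae_of_all _ fun x => ?_)
    simp only
    rw [sub_eq_integral_shift hφ1, integral_const_mul, intervalIntegral.integral_of_le hτ]
    ring
  rw [L1, L2]
  have L3 : ∀ σ : ℝ, ∫ x, u x * fderiv ℝ φ (x - σ • e) e ∂μ =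
      - ∫ x, g (x + σ • e) * φ x ∂μ := by
    intro σ
    have := h _ (hφτ σ) (hcτ σ)
    simp_rw [hfd] at this
    rw [this, ← mp σ (fun x => g x * φ (x - σ • e))]
    simp
  simp_rw [L3]
  rw [integral_neg, neg_neg]
  have hI2 : Integrable (fun p : ℝ × E => g (p.2 + p.1 • e) * φ p.2)
      ((volume.restrict (Ioc 0 τ)).prod μ) := by
    have h1 := integrable_shift hgm hg e τ hc.isCompact (μ := μ)
    obtain ⟨B, hB⟩ := hc.exists_bound_of_continuous hφc
    have h2 : Integrable (fun p : ℝ × E => g (p.2 + p.1 • e) * φ p.2)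
        ((volume.restrict (Ioc 0 τ)).prod (μ.restrict (tsupport φ))) := by
      refine h1.mul_bdd (c := B) ?_ (ae_of_all _ fun p => hB p.2)
      exact (hφc.comp continuous_snd).aestronglyMeasurable
    have h3 : (volume.restrict (Ioc 0 τ)).prod (μ.restrict (tsupport φ)) =
        ((volume.restrict (Ioc 0 τ)).prod μ).restrict (univ ×ˢ tsupport φ) := by
      rw [← Measure.prod_restrict, Measure.restrict_univ]
    rw [h3] at h2
    refine (integrableOn_iff_integrable_of_support_subset ?_).1 h2
    intro p hp
    exact ⟨mem_univ _, subset_tsupport _ (right_ne_zero_of_mul hp)⟩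
  rw [integral_integral_swap (f := fun σ x => g (x + σ • e) * φ x) hI2]
  refine integral_congr_ae (ae_of_all _ fun x => ?_)
  simp only
  rw [integral_mul_const, intervalIntegral.integral_of_le hτ, smul_eq_mul, mul_comm]

/-- A weak directional derivative integrates to increments along almost every segment. -/
theorem ae_shift_sub_eq_of_nonneg (hum : Measurable u) (hgm : Measurable g)
    (hu : LocallyIntegrable u μ) (hg : LocallyIntegrable g μ)
    (h : ∀ φ : E → ℝ, ContDiff ℝ (⊤ : ℕ∞) φ → HasCompactSupport φ →
      ∫ x, u x * fderiv ℝ φ x e ∂μ = - ∫ x, g x * φ x ∂μ) {τ : ℝ} (hτ : 0 ≤ τ) :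
    ∀ᵐ x ∂μ, u (x + τ • e) - u x = ∫ σ in (0 : ℝ)..τ, g (x + σ • e) := by
  refine ae_eq_of_integral_contDiff_smul_eq ?_ ?_
    (fun φ hφ hc => integral_shift_mul hum hgm hu hg h hτ hφ hc)
  · refine LocallyIntegrable.sub ?_ hu
    rw [locallyIntegrable_iff]
    intro K hK
    have hK' : IsCompact ((fun x => x + τ • e) '' K) := hK.image (by fun_prop)
    have := ((measurePreserving_add_right μ (τ • e)).integrableOn_comp_preimage
      (measurableEmbedding_addRight _)).2 (hu.integrableOn_isCompact hK')
    exact this.mono_set (subset_preimage_image _ _)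
  · rw [locallyIntegrable_iff]
    intro K hK
    have := (integrable_shift hgm hg e τ hK (μ := μ)).integral_prod_right
    refine this.congr (ae_of_all _ fun x => ?_)
    simp only
    rw [intervalIntegral.integral_of_le hτ]

theorem ae_shift_sub_eq (hum : Measurable u) (hgm : Measurable g)
    (hu : LocallyIntegrable u μ) (hg : LocallyIntegrable g μ)
    (h : ∀ φ : E → ℝ, ContDiff ℝ (⊤ : ℕ∞) φ → HasCompactSupport φ →
      ∫ x, u x * fderiv ℝ φ x e ∂μ = - ∫ x, g x * φ x ∂μ) (τ : ℝ) :
    ∀ᵐ x ∂μ, u (x + τ • e) - u x = ∫ σ in (0 : ℝ)..τ, g (x + σ • e) := by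
  rcases le_total 0 τ with hτ | hτ
  · exact ae_shift_sub_eq_of_nonneg hum hgm hu hg h hτ
  -- For τ ≤ 0, use the nonnegative case with -τ at the base point x + τe.
  have := (measurePreserving_add_right μ (τ • e)).quasiMeasurePreserving.ae
    (ae_shift_sub_eq_of_nonneg hum hgm hu hg h (neg_nonneg.2 hτ))
  filter_upwards [this] with x hx
  have e1 : x + τ • e + -τ • e = x := by rw [add_assoc, ← add_smul]; simp
  have e2 : ∀ σ : ℝ, x + τ • e + σ • e = x + (τ + σ) • e := fun σ => by
    rw [add_assoc, ← add_smul]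
  rw [e1] at hx
  simp_rw [e2] at hx
  rw [intervalIntegral.integral_comp_add_left (fun σ => g (x + σ • e))] at hx
  simp only [add_zero, add_neg_cancel] at hx
  rw [intervalIntegral.integral_symm, ← hx]
  ring

end Shift

/-! ### Restriction to lines parallel to an axis -/

section Axis

/-- Coordinates on `ℝ^(n+1)` adapted to the lines parallel to the `j`-th axis. -/
noncomputable def lineEquiv {n : ℕ} (j : Fin (n + 1)) :
    ℝ × (Fin n → ℝ) ≃ᵐ EuclideanSpace ℝ (Fin (n + 1)) :=
  (MeasurableEquiv.piFinSuccAbove (fun _ => ℝ) j).symm.trans (MeasurableEquiv.toLp 2 _)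

variable {n : ℕ} {j : Fin (n + 1)}

theorem measurePreserving_lineEquiv (j : Fin (n + 1)) :
    MeasurePreserving (lineEquiv j) (volume.prod volume) volume :=
  ((volume_preserving_piFinSuccAbove (fun _ : Fin (n + 1) => ℝ) j).symm _).trans
    (PiLp.volume_preserving_toLp _)

theorem lineEquiv_apply (t : ℝ) (z : Fin n → ℝ) (i : Fin (n + 1)) :
    lineEquiv j (t, z) i = j.insertNth (α := fun _ => ℝ) t z i :=
  rfl

theorem lineEquiv_add (t τ : ℝ) (z : Fin n → ℝ) :
    lineEquiv j (t + τ, z) = lineEquiv j (t, z) + τ • EuclideanSpace.single j (1 : ℝ) := by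
  ext i
  rcases Fin.eq_self_or_eq_succAbove j i with rfl | ⟨k, rfl⟩
  · simp [lineEquiv_apply]
  · simp [lineEquiv_apply]

theorem lineEquiv_eq (t : ℝ) (z : Fin n → ℝ) :
    lineEquiv j (t, z) = lineEquiv j (0, z) + t • EuclideanSpace.single j (1 : ℝ) := by
  rw [← lineEquiv_add, zero_add]

theorem lintegral_eq_lintegral_lines (j : Fin (n + 1)) {F : EuclideanSpace ℝ (Fin (n + 1)) → ℝ≥0∞}
    (hF : Measurable F) : ∫⁻ x, F x = ∫⁻ z, ∫⁻ t, F (lineEquiv j (t, z)) := by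
  rw [← (measurePreserving_lineEquiv j).lintegral_comp hF]
  exact lintegral_prod_symm' _ (hF.comp (lineEquiv j).measurable)

theorem integral_eq_integral_lines (j : Fin (n + 1)) {F : EuclideanSpace ℝ (Fin (n + 1)) → ℝ}
    (hF : Integrable F) : ∫ x, F x = ∫ z, ∫ t, F (lineEquiv j (t, z)) := by
  rw [← (measurePreserving_lineEquiv j).integral_comp' F]
  refine integral_prod_symm (fun p => F (lineEquiv j p)) ?_
  exact (measurePreserving_lineEquiv j).integrable_comp_of_integrable hF

theorem ae_ae_lines (j : Fin (n + 1)) {P : EuclideanSpace ℝ (Fin (n + 1)) → Prop}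
    (h : ∀ᵐ x, P x) : ∀ᵐ z, ∀ᵐ t, P (lineEquiv j (t, z)) := by
  have h1 : ∀ᵐ p ∂((volume : Measure ℝ).prod (volume : Measure (Fin n → ℝ))), P (lineEquiv j p) :=
    (measurePreserving_lineEquiv j).quasiMeasurePreserving.ae h
  have h2 : ∀ᵐ p ∂((volume : Measure (Fin n → ℝ)).prod (volume : Measure ℝ)),
      P (lineEquiv j p.swap) := Measure.measurePreserving_swap.quasiMeasurePreserving.ae h1
  exact Measure.ae_ae_of_ae_prod h2

/-- A Sobolev function is absolutely continuous on almost every line parallel to an axis. -/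
theorem exists_ac_representative_on_lines {u g : EuclideanSpace ℝ (Fin (n + 1)) → ℝ}
    (hum : Measurable u) (hgm : Measurable g) (hg2 : ∫⁻ x, ENNReal.ofReal (g x ^ 2) ≠ ∞)
    (h : ∀ τ : ℝ, ∀ᵐ x, u (x + τ • EuclideanSpace.single j (1 : ℝ)) - u x =
      ∫ σ in (0 : ℝ)..τ, g (x + σ • EuclideanSpace.single j (1 : ℝ))) :
    ∀ᵐ z, ∫⁻ t, ENNReal.ofReal (g (lineEquiv j (t, z)) ^ 2) ≠ ∞ ∧
      LocallyIntegrable (fun t => g (lineEquiv j (t, z))) ∧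
      ∃ v : ℝ → ℝ, (∀ᵐ t, u (lineEquiv j (t, z)) = v t) ∧
        ∀ a b, v b - v a = ∫ t in a..b, g (lineEquiv j (t, z)) := by
  have hgl : ∀ z, Measurable fun t => g (lineEquiv j (t, z)) := fun z =>
    hgm.comp ((lineEquiv j).measurable.comp measurable_prodMk_right)
  have hfin : ∀ᵐ z, ∫⁻ t, ENNReal.ofReal (g (lineEquiv j (t, z)) ^ 2) < ∞ := by
    have hm : Measurable fun x => ENNReal.ofReal (g x ^ 2) := by fun_prop
    rw [lintegral_eq_lintegral_lines j hm] at hg2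
    refine ae_lt_top ?_ hg2
    exact Measurable.lintegral_prod_left' (hm.comp (lineEquiv j).measurable)
  -- The exceptional null set depends on τ. Fubini in (τ, x), which needs joint measurability,
  -- exchanges the quantifiers so that almost every line and base point work for almost every τ.
  have hinc : ∀ᵐ z, ∀ᵐ r, ∀ᵐ τ, u (lineEquiv j (r + τ, z)) - u (lineEquiv j (r, z)) =
      ∫ t in r..(r + τ), g (lineEquiv j (t, z)) := by
    have hprod : ∀ᵐ p : ℝ × EuclideanSpace ℝ (Fin (n + 1)) ∂(volume.prod volume),
        u (p.2 + p.1 • EuclideanSpace.single j (1 : ℝ)) - u p.2 =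
          ∫ σ in (0 : ℝ)..p.1, g (p.2 + σ • EuclideanSpace.single j (1 : ℝ)) := by
      rw [Measure.ae_prod_iff_ae_ae]
      · exact ae_of_all _ h
      · have m1 : Measurable fun p : ℝ × EuclideanSpace ℝ (Fin (n + 1)) =>
            u (p.2 + p.1 • EuclideanSpace.single j (1 : ℝ)) - u p.2 :=
          (hum.comp (Continuous.measurable (by fun_prop))).sub (hum.comp measurable_snd)
        have m2 : Measurable fun q : (ℝ × EuclideanSpace ℝ (Fin (n + 1))) × ℝ =>
            g (q.1.2 + q.2 • EuclideanSpace.single j (1 : ℝ)) :=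
          hgm.comp (Continuous.measurable (by fun_prop))
        have m3 : Measurable fun p : ℝ × EuclideanSpace ℝ (Fin (n + 1)) =>
            ∫ σ in (0 : ℝ)..p.1, g (p.2 + σ • EuclideanSpace.single j (1 : ℝ)) := by
          simp_rw [intervalIntegral.intervalIntegral_eq_integral_uIoc]
          -- The domain of integration depends on p; an indicator on the product makes it fixed, so
          -- that parametric integrals are measurable.
          have : ∀ p : ℝ × EuclideanSpace ℝ (Fin (n + 1)),
              ∫ σ in uIoc 0 p.1, g (p.2 + σ • EuclideanSpace.single j (1 : ℝ)) =
              ∫ σ, {q : (ℝ × EuclideanSpace ℝ (Fin (n + 1))) × ℝ | q.2 ∈ uIoc 0 q.1.1}.indicator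
                (fun q => g (q.1.2 + q.2 • EuclideanSpace.single j (1 : ℝ))) (p, σ) := by
            intro p
            rw [← integral_indicator measurableSet_uIoc]
            rfl
          simp_rw [this]
          have m4 : Measurable fun p : ℝ × EuclideanSpace ℝ (Fin (n + 1)) =>
              if 0 ≤ p.1 then (1 : ℝ) else -1 :=
            Measurable.ite (measurableSet_le measurable_const measurable_fst)
              measurable_const measurable_const
          refine m4.smul ?_
          refine (Measurable.stronglyMeasurable ?_).integral_prod_right'.measurable
          refine m2.indicator ?_
          simp only [mem_uIoc]
          refine MeasurableSet.union ?_ ?_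
          · exact (measurableSet_lt measurable_const measurable_snd).inter
              (measurableSet_le measurable_snd (measurable_fst.comp measurable_fst))
          · exact (measurableSet_lt (measurable_fst.comp measurable_fst) measurable_snd).inter
              (measurableSet_le measurable_snd measurable_const)
        exact measurableSet_eq_fun m1 m3
    have hsw : ∀ᵐ p : EuclideanSpace ℝ (Fin (n + 1)) × ℝ ∂(volume.prod volume),
        u (p.1 + p.2 • EuclideanSpace.single j (1 : ℝ)) - u p.1 =
          ∫ σ in (0 : ℝ)..p.2, g (p.1 + σ • EuclideanSpace.single j (1 : ℝ)) :=
      Measure.measurePreserving_swap.quasiMeasurePreserving.ae hprod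
    filter_upwards [ae_ae_lines j (Measure.ae_ae_of_ae_prod hsw)] with z hz
    filter_upwards [hz] with r hr
    filter_upwards [hr] with τ hτ
    rw [lineEquiv_add, hτ]
    simp_rw [← lineEquiv_add]
    rw [intervalIntegral.integral_comp_add_left (fun t => g (lineEquiv j (t, z))), add_zero]
  filter_upwards [hfin, hinc] with z hz hi
  have hmem : MemLp (fun t => g (lineEquiv j (t, z))) 2 volume := by
    rw [memLp_two_iff_integrable_sq (hgl z).aestronglyMeasurable]
    refine ⟨((hgl z).pow_const 2).aestronglyMeasurable, ?_⟩
    rwa [hasFiniteIntegral_iff_ofReal (ae_of_all _ fun x => sq_nonneg _)]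
  have hloc : LocallyIntegrable (fun t => g (lineEquiv j (t, z))) :=
    hmem.locallyIntegrable (by norm_num)
  refine ⟨hz.ne, hloc, ?_⟩
  -- One good base point per line suffices: v is the primitive of g normalised to equal u there.
  obtain ⟨r, hr⟩ := hi.exists
  refine ⟨fun t => u (lineEquiv j (r, z)) + ∫ s in r..t, g (lineEquiv j (s, z)), ?_, ?_⟩
  · have := (measurePreserving_add_left (volume : Measure ℝ) (-r)).quasiMeasurePreserving.ae hr
    filter_upwards [this] with t ht
    rw [add_neg_cancel_left] at ht
    linarith
  · intro a b
    have ii := fun a b => intervalIntegrable_of_locallyIntegrable hloc a b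
    rw [add_sub_add_left_eq_sub, intervalIntegral.integral_interval_sub_left (ii _ _) (ii _ _)]

/-- The Gagliardo energy of `f` in the direction of the `j`-th axis. -/
noncomputable def axisEnergy {d : ℕ} (s : ℝ) (j : Fin d) (f : EuclideanSpace ℝ (Fin d) → ℝ) :
    ℝ≥0∞ :=
  ∫⁻ τ : ℝ, ∫⁻ x, ENNReal.ofReal
    ((f (x + τ • EuclideanSpace.single j (1 : ℝ)) - f x) ^ 2 / |τ| ^ (1 + 2 * s))

theorem axisEnergy_eq_lintegral_lineEnergy (s : ℝ) (j : Fin (n + 1))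
    {f : EuclideanSpace ℝ (Fin (n + 1)) → ℝ} (hf : Measurable f) :
    axisEnergy s j f = ∫⁻ z, lineEnergy s univ fun t => f (lineEquiv j (t, z)) := by
  unfold axisEnergy lineEnergy
  simp only [Measure.restrict_univ]
  have hm : Measurable fun p : ℝ × EuclideanSpace ℝ (Fin (n + 1)) => ENNReal.ofReal
      ((f (p.2 + p.1 • EuclideanSpace.single j (1 : ℝ)) - f p.2) ^ 2 / |p.1| ^ (1 + 2 * s)) := by
    have : Measurable fun p : ℝ × EuclideanSpace ℝ (Fin (n + 1)) =>
        f (p.2 + p.1 • EuclideanSpace.single j (1 : ℝ)) :=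
      hf.comp (Continuous.measurable (by fun_prop))
    fun_prop
  rw [lintegral_lintegral_swap hm.aemeasurable,
    lintegral_eq_lintegral_lines j hm.lintegral_prod_left']
  refine lintegral_congr fun z => lintegral_congr fun t => ?_
  rw [← lintegral_sub_right_eq_self _ t]
  refine lintegral_congr fun y => ?_
  simp only
  rw [← lineEquiv_add, add_sub_cancel, abs_sub_comm, ← neg_sub (f (lineEquiv j (t, z))), neg_sq]

theorem lineEnergy_congr (s : ℝ) {f g : ℝ → ℝ} (h : f =ᵐ[volume] g) :
    lineEnergy s univ f = lineEnergy s univ g := by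
  simp only [lineEnergy, Measure.restrict_univ]
  refine lintegral_congr_ae ?_
  filter_upwards [h] with x hx
  refine lintegral_congr_ae ?_
  filter_upwards [h] with y hy
  rw [hx, hy]

/-- Truncating `∂_j u` to `{u > 0}` is bounded for the energy in direction `j`. -/
theorem axisEnergy_indicator_le {s : ℝ} (hs : 0 < s) (hs1 : s < 1 / 2) :
    ∃ C : ℝ≥0, ∀ (n : ℕ) (j : Fin (n + 1)) (u g : EuclideanSpace ℝ (Fin (n + 1)) → ℝ),
    Measurable u → Measurable g → ∫⁻ x, ENNReal.ofReal (g x ^ 2) ≠ ∞ →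
    (∀ τ : ℝ, ∀ᵐ x, u (x + τ • EuclideanSpace.single j (1 : ℝ)) - u x =
      ∫ σ in (0 : ℝ)..τ, g (x + σ • EuclideanSpace.single j (1 : ℝ))) →
    axisEnergy s j ({x | 0 < u x}.indicator g) ≤ C * axisEnergy s j g := by
  obtain ⟨C, hC⟩ := lineEnergy_indicator_le hs hs1
  refine ⟨C, fun n j u g hum hgm hg2 h => ?_⟩
  have hO : MeasurableSet {x | 0 < u x} := measurableSet_lt measurable_const hum
  rw [axisEnergy_eq_lintegral_lineEnergy s j hgm,
    axisEnergy_eq_lintegral_lineEnergy s j (hgm.indicator hO)]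
  rw [← lintegral_const_mul' _ _ ENNReal.coe_ne_top]
  refine lintegral_mono_ae ?_
  filter_upwards [exists_ac_representative_on_lines hum hgm hg2 h] with z ⟨hz, hloc, v, huv, hv⟩
  have hgl : Measurable fun t => g (lineEquiv j (t, z)) :=
    hgm.comp ((lineEquiv j).measurable.comp measurable_prodMk_right)
  refine le_trans (le_of_eq ?_) (hC v _ (continuous_of_integral hloc hv) hgl hz hv)
  refine lineEnergy_congr s ?_
  filter_upwards [huv] with t ht
  simp [indicator, ht]

/-- The weak chain rule for the positive part, in one coordinate direction. -/
theorem integral_max_zero_mul_fderiv {u g : EuclideanSpace ℝ (Fin (n + 1)) → ℝ}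
    (hum : Measurable u) (hgm : Measurable g) (hg2 : ∫⁻ x, ENNReal.ofReal (g x ^ 2) ≠ ∞)
    (hu : LocallyIntegrable u) (hg : LocallyIntegrable g)
    (h : ∀ τ : ℝ, ∀ᵐ x, u (x + τ • EuclideanSpace.single j (1 : ℝ)) - u x =
      ∫ σ in (0 : ℝ)..τ, g (x + σ • EuclideanSpace.single j (1 : ℝ)))
    {φ : EuclideanSpace ℝ (Fin (n + 1)) → ℝ} (hφ : ContDiff ℝ (⊤ : ℕ∞) φ)
    (hc : HasCompactSupport φ) :
    ∫ x, max (u x) 0 * fderiv ℝ φ x (EuclideanSpace.single j (1 : ℝ)) =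
      - ∫ x, {x | 0 < u x}.indicator g x * φ x := by
  have hO : MeasurableSet {x | 0 < u x} := measurableSet_lt measurable_const hum
  have hφ1 : ContDiff ℝ 1 φ := hφ.of_le (by exact_mod_cast le_top)
  have hdc : Continuous fun x => fderiv ℝ φ x (EuclideanSpace.single j (1 : ℝ)) := by
    have := hφ1.continuous_fderiv one_ne_zero
    fun_prop
  have hup : LocallyIntegrable fun x => max (u x) 0 := by
    refine hu.mono (hum.max measurable_const).aestronglyMeasurable (ae_of_all _ fun x => ?_)
    rw [Real.norm_eq_abs, Real.norm_eq_abs, abs_of_nonneg (le_max_right _ _)]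
    exact max_le (le_abs_self _) (abs_nonneg _)
  have hgi : LocallyIntegrable ({x | 0 < u x}.indicator g) :=
    hg.mono (hgm.indicator hO).aestronglyMeasurable
      (ae_of_all _ fun x => norm_indicator_le_norm_self _ _)
  have i1 : Integrable fun x =>
      max (u x) 0 * fderiv ℝ φ x (EuclideanSpace.single j (1 : ℝ)) :=
    hup.integrable_smul_right_of_hasCompactSupport hdc (hc.fderiv_apply ℝ _)
  have i2 : Integrable fun x => {x | 0 < u x}.indicator g x * φ x :=
    hgi.integrable_smul_right_of_hasCompactSupport hφ.continuous hc
  rw [integral_eq_integral_lines j i1, integral_eq_integral_lines j i2, ← integral_neg]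
  refine integral_congr_ae ?_
  filter_upwards [exists_ac_representative_on_lines hum hgm hg2 h] with z ⟨hz, hloc, v, huv, hv⟩
  set e := EuclideanSpace.single j (1 : ℝ)
  obtain ⟨p, haff⟩ : ∃ p, ∀ t : ℝ, lineEquiv j (t, z) = p + t • e :=
    ⟨_, fun t => lineEquiv_eq t z⟩
  have hφl : ContDiff ℝ 1 fun t : ℝ => φ (lineEquiv j (t, z)) := by
    simp_rw [haff]
    exact hφ1.comp (contDiff_const.add (contDiff_id.smul contDiff_const))
  have hcl : HasCompactSupport fun t : ℝ => φ (lineEquiv j (t, z)) := by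
    have hi : Isometry fun t : ℝ => p + t • e := by
      refine Isometry.of_dist_eq fun a b => ?_
      rw [dist_add_left, dist_eq_norm, ← sub_smul, norm_smul]
      simp [e, Real.dist_eq]
    simp_rw [haff]
    exact hc.comp_isClosedEmbedding hi.isClosedEmbedding
  have hder : ∀ t, deriv (fun t : ℝ => φ (lineEquiv j (t, z))) t =
      fderiv ℝ φ (lineEquiv j (t, z)) e := by
    intro t
    simp_rw [haff]
    have h1 : HasDerivAt (fun σ : ℝ => p + σ • e) e t := by
      simpa using ((hasDerivAt_id t).smul_const e).const_add p
    exact (((hφ1.differentiable one_ne_zero) _).hasFDerivAt.comp_hasDerivAt t h1).deriv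
  have key := integral_max_zero_mul_deriv hloc hv hφl hcl
  simp_rw [hder] at key
  refine (integral_congr_ae ?_).trans (key.trans (congrArg Neg.neg (integral_congr_ae ?_)))
  · filter_upwards [huv] with t ht
    rw [ht]
  · filter_upwards [huv] with t ht
    simp [indicator, ht]

end Axis

/-! ### The L² Fourier transform by duality -/

open FourierTransform

/-- The character `ξ ↦ exp (2πi⟨h, ξ⟩)`. -/
noncomputable def character {E : Type*} [NormedAddCommGroup E] [InnerProductSpace ℝ E]
    (h ξ : E) : ℂ :=
  Complex.exp (((2 * Real.pi * inner ℝ h ξ : ℝ) : ℂ) * Complex.I)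

theorem norm_character {E : Type*} [NormedAddCommGroup E] [InnerProductSpace ℝ E]
    (h ξ : E) : ‖character h ξ‖ = 1 := Complex.norm_exp_ofReal_mul_I _

theorem contDiff_character {E : Type*} [NormedAddCommGroup E]
    [InnerProductSpace ℝ E] (h : E) : ContDiff ℝ (⊤ : ℕ∞) (character h) := by
  unfold character
  have h1 : ContDiff ℝ (⊤ : ℕ∞) fun ξ : E => 2 * Real.pi * inner ℝ h ξ :=
    contDiff_const.mul (contDiff_const.inner ℝ contDiff_id)
  have h2 : ContDiff ℝ (⊤ : ℕ∞) fun ξ : E => ((2 * Real.pi * inner ℝ h ξ : ℝ) : ℂ) :=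
    Complex.ofRealCLM.contDiff.comp h1
  exact (h2.mul contDiff_const).cexp

section Fourier

variable {E : Type*} [NormedAddCommGroup E] [InnerProductSpace ℝ E] [FiniteDimensional ℝ E]
  [MeasurableSpace E] [BorelSpace E]

/-- `F` is the `L²` Fourier transform of `f`. -/
structure IsL2Fourier (f F : E → ℂ) : Prop where
  memLp : MemLp f 2
  memLp_fourier : MemLp F 2
  integral_eq : ∀ ψ : E → ℂ, ContDiff ℝ (⊤ : ℕ∞) ψ → HasCompactSupport ψ →
    ∫ x, ψ x * F x = ∫ x, 𝓕 ψ x * f x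

theorem IsL2Fourier.toLp {f : E → ℂ} (hf : MemLp f 2) :
    IsL2Fourier f (𝓕 hf.toLp : Lp (α := E) ℂ 2) := by
  refine ⟨hf, Lp.memLp _, fun ψ hψ hc => ?_⟩
  -- The L² transform agrees with the distributional one, which is defined by transposition;
  -- evaluating at ψ gives the identity.
  have h := congrArg (fun T => T (hc.toSchwartzMap hψ))
    (Lp.fourier_toTemperedDistribution_eq (hf.toLp : Lp (α := E) ℂ 2))
  simp only [TemperedDistribution.fourier_apply, Lp.toTemperedDistribution_apply] at h
  simp only [smul_eq_mul, HasCompactSupport.toSchwartzMap_toFun, SchwartzMap.fourier_coe] at h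
  refine h.symm.trans (integral_congr_ae ?_)
  filter_upwards [hf.coeFn_toLp] with x hx
  rw [hx]
  rfl

theorem _root_.MeasureTheory.MemLp.exists_isL2Fourier {f : E → ℂ} (hf : MemLp f 2) :
    ∃ F, IsL2Fourier f F :=
  ⟨_, .toLp hf⟩

theorem ae_eq_of_integral_contDiff_mul_eq {F G : E → ℂ} (hF : LocallyIntegrable F)
    (hG : LocallyIntegrable G) (h : ∀ ψ : E → ℂ, ContDiff ℝ (⊤ : ℕ∞) ψ → HasCompactSupport ψ →
    ∫ x, ψ x * F x = ∫ x, ψ x * G x) : F =ᵐ[volume] G := by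
  refine ae_eq_of_integral_contDiff_smul_eq hF hG fun g hg hc => ?_
  have := h (fun x => (g x : ℂ)) (Complex.ofRealCLM.contDiff.comp hg)
    (hc.comp_left Complex.ofReal_zero)
  simpa using this

theorem IsL2Fourier.unique {f F G : E → ℂ} (hF : IsL2Fourier f F) (hG : IsL2Fourier f G) :
    F =ᵐ[volume] G :=
  ae_eq_of_integral_contDiff_mul_eq (hF.memLp_fourier.locallyIntegrable (by norm_num))
    (hG.memLp_fourier.locallyIntegrable (by norm_num)) fun ψ h1 h2 => by
      rw [hF.integral_eq ψ h1 h2, hG.integral_eq ψ h1 h2]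

/-- Plancherel's theorem. -/
theorem IsL2Fourier.eLpNorm_eq {f F : E → ℂ} (h : IsL2Fourier f F) :
    eLpNorm F 2 volume = eLpNorm f 2 volume := by
  rw [eLpNorm_congr_ae (h.unique (.toLp h.memLp)), ← Lp.enorm_def,
    ← ofReal_norm, Lp.norm_fourier_eq, ofReal_norm, Lp.enorm_def]
  exact eLpNorm_congr_ae h.memLp.coeFn_toLp

theorem IsL2Fourier.lintegral_eq {f F : E → ℂ} (h : IsL2Fourier f F) :
    ∫⁻ ξ, ENNReal.ofReal (‖F ξ‖ ^ 2) = ∫⁻ x, ENNReal.ofReal (‖f x‖ ^ 2) := by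
  have key : ∀ g : E → ℂ, ∫⁻ x, ENNReal.ofReal (‖g x‖ ^ 2) = eLpNorm g 2 volume ^ 2 := by
    intro g
    rw [eLpNorm_eq_lintegral_rpow_enorm_toReal (by norm_num) (by norm_num),
      ← ENNReal.rpow_natCast, ← ENNReal.rpow_mul]
    norm_num [ENNReal.ofReal_pow (norm_nonneg _), ofReal_norm]
  rw [key, key, h.eLpNorm_eq]

theorem IsL2Fourier.sub {f F g G : E → ℂ} (hf : IsL2Fourier f F) (hg : IsL2Fourier g G) :
    IsL2Fourier (f - g) (F - G) := by
  refine ⟨hf.memLp.sub hg.memLp, hf.memLp_fourier.sub hg.memLp_fourier, fun ψ h1 h2 => ?_⟩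
  have hψ : MemLp ψ 2 := h1.continuous.memLp_of_hasCompactSupport h2
  have hψ' : MemLp (𝓕 ψ) 2 := by
    have := (𝓕 (h2.toSchwartzMap h1)).memLp 2 (volume : Measure E)
    rwa [SchwartzMap.fourier_coe] at this
  simp only [Pi.sub_apply, mul_sub]
  have hmul : ∀ {a b : E → ℂ}, MemLp a 2 → MemLp b 2 → Integrable (fun x => a x * b x) :=
    fun ha hb => ha.integrable_mul hb
  rw [integral_sub (hmul hψ hf.memLp_fourier) (hmul hψ hg.memLp_fourier),
    integral_sub (hmul hψ' hf.memLp) (hmul hψ' hg.memLp), hf.integral_eq ψ h1 h2,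
    hg.integral_eq ψ h1 h2]

theorem fourier_sub_shift (ψ : E → ℂ) (h x : E) :
    𝓕 ψ (x - h) = 𝓕 (fun ξ => character h ξ * ψ ξ) x := by
  rw [Real.fourier_eq', Real.fourier_eq']
  refine integral_congr_ae (ae_of_all _ fun ξ => ?_)
  simp only [character, smul_eq_mul]
  rw [← mul_assoc, ← Complex.exp_add, ← add_mul, ← Complex.ofReal_add]
  congr 5
  rw [inner_sub_right, real_inner_comm ξ h]
  ring

theorem IsL2Fourier.shift {f F : E → ℂ} (hf : IsL2Fourier f F) (h : E) :
    IsL2Fourier (fun x => f (x + h)) (fun ξ => character h ξ * F ξ) := by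
  refine ⟨hf.memLp.comp_measurePreserving (measurePreserving_add_right volume h), ?_,
    fun ψ h1 h2 => ?_⟩
  · refine hf.memLp_fourier.of_le
      ((contDiff_character h).continuous.aestronglyMeasurable.mul
        hf.memLp_fourier.aestronglyMeasurable) (ae_of_all _ fun ξ => ?_)
    rw [norm_mul, norm_character, one_mul]
  · have e := hf.integral_eq (fun ξ => character h ξ * ψ ξ) ((contDiff_character h).mul h1)
      h2.mul_left
    have e2 : ∀ ξ, ψ ξ * (character h ξ * F ξ) = character h ξ * ψ ξ * F ξ := fun ξ => by ring
    simp_rw [e2]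
    rw [e, ← integral_add_right_eq_self _ h]
    refine integral_congr_ae (ae_of_all _ fun x => ?_)
    simp only
    rw [← fourier_sub_shift, add_sub_cancel_right]

/-- The Fourier side of the mean square increment of `f` in direction `h`. -/
theorem IsL2Fourier.lintegral_increment {f F : E → ℂ} (hf : IsL2Fourier f F) (h : E) :
    ∫⁻ x, ENNReal.ofReal (‖f (x + h) - f x‖ ^ 2) =
      ∫⁻ ξ, ENNReal.ofReal (‖character h ξ - 1‖ ^ 2 * ‖F ξ‖ ^ 2) := by
  have := ((hf.shift h).sub hf).lintegral_eq
  simp only [Pi.sub_apply] at this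
  rw [← this]
  refine lintegral_congr fun ξ => ?_
  rw [← mul_pow, ← norm_mul, sub_mul, one_mul]

end Fourier

/-! ### Weak derivatives on the Fourier side -/

section Fourier

variable {E : Type*} [NormedAddCommGroup E] [InnerProductSpace ℝ E] [FiniteDimensional ℝ E]
  [MeasurableSpace E] [BorelSpace E]

theorem integral_weakDeriv_complex {w g : E → ℝ} {e : E} (hw : LocallyIntegrable w)
    (hg : LocallyIntegrable g)
    (h : ∀ φ : E → ℝ, ContDiff ℝ (⊤ : ℕ∞) φ → HasCompactSupport φ →
      ∫ x, w x * fderiv ℝ φ x e = - ∫ x, g x * φ x)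
    {ψ : E → ℂ} (hψ : ContDiff ℝ (⊤ : ℕ∞) ψ) (hc : HasCompactSupport ψ) :
    ∫ x, (w x : ℂ) * fderiv ℝ ψ x e = - ∫ x, (g x : ℂ) * ψ x := by
  have hψ1 : ContDiff ℝ 1 ψ := hψ.of_le (by exact_mod_cast le_top)
  have hdc : Continuous fun x => fderiv ℝ ψ x e := by
    have := hψ1.continuous_fderiv one_ne_zero
    fun_prop
  have i1 : Integrable fun x => (w x : ℂ) * fderiv ℝ ψ x e := by
    simpa using hw.integrable_smul_right_of_hasCompactSupport hdc (hc.fderiv_apply ℝ e)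
  have i2 : Integrable fun x => (g x : ℂ) * ψ x := by
    simpa using hg.integrable_smul_right_of_hasCompactSupport hψ.continuous hc
  -- Real and imaginary parts of ψ are admissible real test functions.
  have key : ∀ L : ℂ →L[ℝ] ℝ, L (∫ x, (w x : ℂ) * fderiv ℝ ψ x e) =
      L (- ∫ x, (g x : ℂ) * ψ x) := by
    intro L
    rw [map_neg, ← L.integral_comp_comm i1, ← L.integral_comp_comm i2]
    have hd : ∀ x, L (fderiv ℝ ψ x e) = fderiv ℝ (fun x => L (ψ x)) x e := by
      intro x
      have := (L.hasFDerivAt.comp x (hψ1.differentiable one_ne_zero x).hasFDerivAt).fderiv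
      rw [show (fun x => L (ψ x)) = L ∘ ψ from rfl, this]
      rfl
    have hs : ∀ (a : ℝ) (b : ℂ), L ((a : ℂ) * b) = a * L b := by
      intro a b
      rw [← Complex.real_smul, map_smul, smul_eq_mul]
    simp_rw [hs, hd]
    exact h _ (L.contDiff.comp hψ) (hc.comp_left (map_zero L))
  exact Complex.ext (key Complex.reCLM) (key Complex.imCLM)

/-- Weak derivatives of `L²` functions may be tested against Schwartz functions. -/
theorem integral_weakDeriv_schwartz {w g : E → ℝ} {e : E} (hw : MemLp w 2) (hg : MemLp g 2)
    (h : ∀ φ : E → ℝ, ContDiff ℝ (⊤ : ℕ∞) φ → HasCompactSupport φ →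
      ∫ x, w x * fderiv ℝ φ x e = - ∫ x, g x * φ x) (φ : SchwartzMap E ℂ) :
    ∫ x, (w x : ℂ) * fderiv ℝ φ x e = - ∫ x, (g x : ℂ) * φ x := by
  set η : ContDiffBump (0 : E) := ⟨1, 2, one_pos, one_lt_two⟩
  set c : ℕ → ℝ := fun k => ((k : ℝ) + 1)⁻¹
  have hc0 : ∀ k, 0 < c k := fun k => by positivity
  have hc1 : ∀ k, c k ≤ 1 := fun k => inv_le_one_of_one_le₀ (by
    have := k.cast_nonneg (α := ℝ); linarith)
  have hclim : Filter.Tendsto c Filter.atTop (nhds 0) := by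
    simpa [c] using tendsto_one_div_add_atTop_nhds_zero_nat (𝕜 := ℝ)
  have hη : ContDiff ℝ (⊤ : ℕ∞) η := η.contDiff
  have hηd : Continuous (fderiv ℝ η) := hη.continuous_fderiv (by simp)
  have hηcs : HasCompactSupport η := η.hasCompactSupport
  obtain ⟨M, hM⟩ := (hηcs.fderiv (𝕜 := ℝ)).exists_bound_of_continuous hηd
  -- Cut-offs at scale k + 1: they tend to 1, and their gradients carry a factor 1/(k + 1), so the
  -- error term vanishes by dominated convergence.
  set θ : ℕ → E → ℝ := fun k x => η (c k • x)
  have hθ : ∀ k, ContDiff ℝ (⊤ : ℕ∞) (θ k) := fun k =>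
    hη.comp (contDiff_const.smul contDiff_id)
  have hθd : ∀ k x, HasFDerivAt (θ k) (c k • fderiv ℝ η (c k • x)) x := by
    intro k x
    have h1 : HasFDerivAt (fun x : E => c k • x) (c k • ContinuousLinearMap.id ℝ E) x :=
      (hasFDerivAt_id x).const_smul (c k)
    have h2 := ((hη.differentiable (by simp)) (c k • x)).hasFDerivAt.comp x h1
    convert! h2 using 1
    ext y
    simp
  have hφ : ContDiff ℝ (⊤ : ℕ∞) φ := φ.smooth _
  have hprod : ∀ k, ContDiff ℝ (⊤ : ℕ∞) fun x => (θ k x : ℂ) * φ x := fun k =>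
    (Complex.ofRealCLM.contDiff.comp (hθ k)).mul hφ
  have hθcs : ∀ k, HasCompactSupport (θ k) := fun k =>
    hηcs.comp_smul (hc0 k).ne'
  have hcs : ∀ k, HasCompactSupport fun x => (θ k x : ℂ) * φ x := fun k =>
    ((hθcs k).comp_left Complex.ofReal_zero).mul_right
  have hder : ∀ k x, fderiv ℝ (fun x => (θ k x : ℂ) * φ x) x e =
      (θ k x : ℂ) * fderiv ℝ φ x e + (c k * fderiv ℝ η (c k • x) e : ℝ) * φ x := by
    intro k x
    have h1 : HasFDerivAt (fun x => (θ k x : ℂ))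
        (Complex.ofRealCLM.comp (c k • fderiv ℝ η (c k • x))) x :=
      Complex.ofRealCLM.hasFDerivAt.comp x (hθd k x)
    have h2 := (h1.mul ((hφ.differentiable (by simp)) x).hasFDerivAt).fderiv
    rw [show (fun x => (θ k x : ℂ) * φ x) = (fun x => (θ k x : ℂ)) * ⇑φ from rfl, h2]
    simp
    ring
  have hk := fun k => integral_weakDeriv_complex (hw.locallyIntegrable (by norm_num))
    (hg.locallyIntegrable (by norm_num)) h (hprod k) (hcs k)
  simp_rw [hder] at hk
  have hθlim : ∀ x, Filter.Tendsto (fun k => θ k x) Filter.atTop (nhds 1) := by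
    intro x
    have h1 : Filter.Tendsto (fun k => c k • x) Filter.atTop (nhds 0) := by
      simpa using hclim.smul_const x
    have h2 := (hη.continuous.tendsto 0).comp h1
    rwa [show η 0 = 1 from η.one_of_mem_closedBall (by simp [η])] at h2
  have hθ1 : ∀ k x, |θ k x| ≤ 1 := fun k x => by
    rw [abs_of_nonneg η.nonneg]; exact η.le_one
  have hφd : MemLp (fun x => fderiv ℝ φ x e) 2 := by
    have := (LineDeriv.lineDerivOp e φ : SchwartzMap E ℂ).memLp 2 (volume : Measure E)
    exact this
  have hφ2 : MemLp φ 2 := φ.memLp 2 volume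
  have lim1 : Filter.Tendsto (fun k => ∫ x, (w x : ℂ) * ((θ k x : ℂ) * fderiv ℝ φ x e +
      (c k * fderiv ℝ η (c k • x) e : ℝ) * φ x)) Filter.atTop
      (nhds (∫ x, (w x : ℂ) * fderiv ℝ φ x e)) := by
    refine tendsto_integral_of_dominated_convergence
      (fun x => ‖w x‖ * ‖fderiv ℝ φ x e‖ + (M * ‖e‖) * (‖w x‖ * ‖φ x‖)) (fun k => ?_) ?_
      (fun k => ae_of_all _ fun x => ?_) (ae_of_all _ fun x => ?_)
    · refine (Complex.continuous_ofReal.comp_aestronglyMeasurable hw.aestronglyMeasurable).mul ?_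
      refine AEStronglyMeasurable.add ?_ ?_
      · exact (Complex.continuous_ofReal.comp (hθ k).continuous).aestronglyMeasurable.mul
          hφd.aestronglyMeasurable
      · refine Continuous.aestronglyMeasurable ?_
        have := φ.continuous
        fun_prop
    · exact (hw.norm.integrable_mul hφd.norm).add ((hw.norm.integrable_mul hφ2.norm).const_mul _)
    · rw [norm_mul, Complex.norm_real]
      have b1 : ‖(θ k x : ℂ) * fderiv ℝ φ x e‖ ≤ ‖fderiv ℝ φ x e‖ := by
        rw [norm_mul, Complex.norm_real]
        exact mul_le_of_le_one_left (norm_nonneg _) (hθ1 k x)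
      have b2 : ‖((c k * fderiv ℝ η (c k • x) e : ℝ) : ℂ) * φ x‖ ≤ M * ‖e‖ * ‖φ x‖ := by
        rw [norm_mul, Complex.norm_real, norm_mul, Real.norm_of_nonneg (hc0 k).le]
        refine mul_le_mul_of_nonneg_right ?_ (norm_nonneg _)
        have := ((fderiv ℝ η (c k • x)).le_opNorm e).trans
          (mul_le_mul_of_nonneg_right (hM (c k • x)) (norm_nonneg e))
        exact (mul_le_of_le_one_left (norm_nonneg _) (hc1 k)).trans this
      calc _ ≤ ‖w x‖ * (‖fderiv ℝ φ x e‖ + M * ‖e‖ * ‖φ x‖) := by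
            gcongr
            exact (norm_add_le _ _).trans (add_le_add b1 b2)
        _ = _ := by ring
    · have h1 : Filter.Tendsto (fun k => (θ k x : ℂ) * fderiv ℝ φ x e) Filter.atTop
          (nhds (fderiv ℝ φ x e)) := by
        simpa using ((Complex.continuous_ofReal.tendsto _).comp (hθlim x)).mul_const
          (fderiv ℝ φ x e)
      have h2 : Filter.Tendsto (fun k => c k * fderiv ℝ η (c k • x) e) Filter.atTop
          (nhds 0) := by
        have h3 : Filter.Tendsto (fun k => c k • x) Filter.atTop (nhds 0) := by
          simpa using hclim.smul_const x
        have h4 : Filter.Tendsto (fun k => fderiv ℝ η (c k • x) e) Filter.atTop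
            (nhds (fderiv ℝ η 0 e)) :=
          ((hηd.clm_apply continuous_const).tendsto 0).comp h3
        simpa using hclim.mul h4
      have h5 := (((Complex.continuous_ofReal.tendsto _).comp h2).mul_const (φ x))
      simpa using (h1.add h5).const_mul (w x : ℂ)
  have lim2 : Filter.Tendsto (fun k => - ∫ x, (g x : ℂ) * ((θ k x : ℂ) * φ x)) Filter.atTop
      (nhds (- ∫ x, (g x : ℂ) * φ x)) := by
    refine Filter.Tendsto.neg ?_
    refine tendsto_integral_of_dominated_convergence
      (fun x => ‖g x‖ * ‖φ x‖) (fun k => ?_) (hg.norm.integrable_mul hφ2.norm)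
      (fun k => ae_of_all _ fun x => ?_) (ae_of_all _ fun x => ?_)
    · exact (Complex.continuous_ofReal.comp_aestronglyMeasurable hg.aestronglyMeasurable).mul
        (hprod k).continuous.aestronglyMeasurable
    · rw [norm_mul, norm_mul, Complex.norm_real, Complex.norm_real]
      gcongr
      exact mul_le_of_le_one_left (norm_nonneg _) (hθ1 k x)
    · simpa using (((Complex.continuous_ofReal.tendsto _).comp (hθlim x)).mul_const
          (φ x)).const_mul (g x : ℂ)
  refine tendsto_nhds_unique lim1 ?_
  simp_rw [hk]
  exact lim2

/-- The Fourier transform turns a weak directional derivative into a multiplication. -/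
theorem fourier_weakDeriv_ae_eq {w g : E → ℝ} {W G : E → ℂ} {e : E}
    (hw : MemLp w 2) (hg : MemLp g 2)
    (h : ∀ φ : E → ℝ, ContDiff ℝ (⊤ : ℕ∞) φ → HasCompactSupport φ →
      ∫ x, w x * fderiv ℝ φ x e = - ∫ x, g x * φ x)
    (hW : IsL2Fourier (fun x => (w x : ℂ)) W) (hG : IsL2Fourier (fun x => (g x : ℂ)) G) :
    G =ᵐ[volume] fun ξ => 2 * Real.pi * Complex.I * (inner ℝ ξ e : ℝ) * W ξ := by
  have hcont : Continuous fun ξ : E => 2 * Real.pi * Complex.I * ((inner ℝ ξ e : ℝ) : ℂ) := by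
    fun_prop
  refine ae_eq_of_integral_contDiff_mul_eq (hG.memLp_fourier.locallyIntegrable (by norm_num)) ?_ ?_
  · exact (hW.memLp_fourier.locallyIntegrable (by norm_num)).continuous_smul hcont
  · intro ψ h1 h2
    have hm : ContDiff ℝ (⊤ : ℕ∞) fun ξ => 2 * Real.pi * Complex.I * (inner ℝ ξ e : ℝ) * ψ ξ := by
      have : ContDiff ℝ (⊤ : ℕ∞) fun ξ : E => ((inner ℝ ξ e : ℝ) : ℂ) :=
        Complex.ofRealCLM.contDiff.comp (contDiff_id.inner ℝ contDiff_const)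
      exact (contDiff_const.mul this).mul h1
    have hms : HasCompactSupport fun ξ => 2 * Real.pi * Complex.I * (inner ℝ ξ e : ℝ) * ψ ξ :=
      h2.mul_left
    have e1 := hW.integral_eq _ hm hms
    have e2 : ∀ ξ, ψ ξ * (2 * Real.pi * Complex.I * (inner ℝ ξ e : ℝ) * W ξ) =
        2 * Real.pi * Complex.I * (inner ℝ ξ e : ℝ) * ψ ξ * W ξ := fun ξ => by ring
    simp_rw [e2]
    rw [e1, hG.integral_eq ψ h1 h2]
    set Ψ := h2.toSchwartzMap h1
    set Φ : SchwartzMap E ℂ := 𝓕 Ψ with hΦ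
    -- The test function here is 𝓕 ψ, which is Schwartz but need not have compact support.
    have hS := integral_weakDeriv_schwartz hw hg h Φ
    have e3 : ∀ x, fderiv ℝ Φ x e =
        - 𝓕 (fun ξ => 2 * Real.pi * Complex.I * (inner ℝ ξ e : ℝ) * ψ ξ) x := by
      intro x
      have ht : (fun ξ : E => inner ℝ ξ e).HasTemperateGrowth := by fun_prop
      have h3 := congrArg (fun S : SchwartzMap E ℂ => S x)
        (SchwartzMap.lineDerivOp_fourier_eq (E := ℂ) Ψ e)
      simp only [SchwartzMap.fourier_coe, ← hΦ] at h3
      refine Eq.trans h3 ?_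
      rw [Real.fourier_eq, Real.fourier_eq, ← integral_neg]
      refine integral_congr_ae (ae_of_all _ fun ξ => ?_)
      simp [SchwartzMap.smulLeftCLM_apply_apply ht, Ψ, Circle.smul_def]
      ring
    simp_rw [e3] at hS
    simp only [mul_neg, integral_neg, neg_inj] at hS
    have c1 : ∀ x, 𝓕 ψ x * (g x : ℂ) = (g x : ℂ) * Φ x := fun x => by
      rw [mul_comm]; rfl
    simp_rw [c1, ← hS, mul_comm]

end Fourier

/-! ### The Fourier symbol of the Gagliardo energy -/

section Kernel

variable {E : Type*} [NormedAddCommGroup E] [InnerProductSpace ℝ E] [FiniteDimensional ℝ E]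
  [MeasurableSpace E] [BorelSpace E]

/-- The symbol of the Gagliardo energy of order `s`. -/
noncomputable def gagliardoSymbol (s : ℝ) (ξ : E) : ℝ≥0∞ :=
  ∫⁻ h : E, ENNReal.ofReal (‖character h ξ - 1‖ ^ 2 / ‖h‖ ^ (Module.finrank ℝ E + 2 * s))

theorem norm_character_sub_one_le {E : Type*} [NormedAddCommGroup E] [InnerProductSpace ℝ E]
    (h ξ : E) : ‖character h ξ - 1‖ ≤ 2 * Real.pi * (‖h‖ * ‖ξ‖) := by
  have h1 := Real.norm_exp_I_mul_ofReal_sub_one_le (x := 2 * Real.pi * inner ℝ h ξ)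
  rw [mul_comm Complex.I] at h1
  refine h1.trans ?_
  rw [norm_mul, Real.norm_of_nonneg (by positivity)]
  gcongr
  exact norm_inner_le_norm h ξ

theorem continuous_character_left {E : Type*} [NormedAddCommGroup E] [InnerProductSpace ℝ E]
    (ξ : E) : Continuous fun h : E => character h ξ := by
  unfold character
  fun_prop

theorem gagliardoSymbol_smul (s : ℝ) {r : ℝ} (hr : 0 < r) (ξ : E) :
    gagliardoSymbol s (r • ξ) = ENNReal.ofReal (r ^ (2 * s)) * gagliardoSymbol s ξ := by
  unfold gagliardoSymbol
  set D : ℝ := Module.finrank ℝ E + 2 * s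
  set F : E → ℝ≥0∞ := fun h => ENNReal.ofReal (‖character h ξ - 1‖ ^ 2 / ‖h‖ ^ D)
  have hF : Measurable F := by
    have := continuous_character_left ξ
    fun_prop
  have e : ∀ h : E, ENNReal.ofReal (‖character h (r • ξ) - 1‖ ^ 2 / ‖h‖ ^ D) =
      ENNReal.ofReal (r ^ D) * F (r • h) := by
    intro h
    have h1 : character h (r • ξ) = character (r • h) ξ := by
      simp [character, inner_smul_left, inner_smul_right]
    rw [← ENNReal.ofReal_mul (by positivity), h1, norm_smul, Real.norm_of_nonneg hr.le,
      Real.mul_rpow hr.le (norm_nonneg _)]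
    congr 1
    rw [← mul_div_assoc, mul_div_mul_left _ _ (Real.rpow_pos_of_pos hr D).ne']
  simp_rw [e]
  rw [lintegral_const_mul _ (show Measurable fun h => F (r • h) from
      hF.comp (measurable_const_smul r)),
    ← lintegral_map hF (measurable_const_smul r), Measure.map_addHaar_smul volume hr.ne',
    lintegral_smul_measure, smul_eq_mul, ← mul_assoc, ← ENNReal.ofReal_mul (by positivity)]
  congr 2
  rw [abs_of_pos (by positivity), Real.rpow_add hr, Real.rpow_natCast]
  field_simp

theorem gagliardoSymbol_map (s : ℝ) (A : E ≃ₗᵢ[ℝ] E) (ξ : E) :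
    gagliardoSymbol s (A ξ) = gagliardoSymbol s ξ := by
  unfold gagliardoSymbol
  rw [← A.measurePreserving.lintegral_comp_emb A.toHomeomorph.measurableEmbedding]
  simp [character]

/-- The symbol is homogeneous of degree 2s and invariant under isometries, and a reflection carries
e₀ to ξ/‖ξ‖. At ξ = 0 both sides vanish, as s > 0. -/
theorem gagliardoSymbol_eq {s : ℝ} (hs : 0 < s) {e₀ : E} (he : ‖e₀‖ = 1) (ξ : E) :
    gagliardoSymbol s ξ = ENNReal.ofReal (‖ξ‖ ^ (2 * s)) * gagliardoSymbol s e₀ := by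
  rcases eq_or_ne ξ 0 with rfl | hξ
  · simp [gagliardoSymbol, character, Real.zero_rpow (show 2 * s ≠ 0 by linarith)]
  have hp : 0 < ‖ξ‖ := norm_pos_iff.2 hξ
  obtain ⟨A, hA⟩ : ∃ A : E ≃ₗᵢ[ℝ] E, A e₀ = ‖ξ‖⁻¹ • ξ := by
    refine ⟨_, Submodule.reflection_sub ?_⟩
    rw [he, norm_smul, norm_inv, norm_norm, inv_mul_cancel₀ hp.ne']
  rw [← gagliardoSymbol_map s A e₀, hA, ← gagliardoSymbol_smul s hp, smul_smul,
    mul_inv_cancel₀ hp.ne', one_smul]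

/-- Near 0 the numerator is O(‖h‖²), integrable against the kernel because s < 1; away from 0 it is
at most 4 and the kernel decays integrably because s > 0. -/
theorem gagliardoSymbol_ne_top {s : ℝ} (hs : 0 < s) (hs1 : s < 1) {e₀ : E} (he : ‖e₀‖ = 1) :
    gagliardoSymbol s e₀ ≠ ∞ := by
  have hnt : Nontrivial E := ⟨e₀, 0, fun h => by simp [h] at he⟩
  have hdim : 1 ≤ Module.finrank ℝ E := Module.finrank_pos
  set D : ℝ := Module.finrank ℝ E + 2 * s with hD
  set f : E → ℝ := fun h => ‖character h e₀ - 1‖ ^ 2 / ‖h‖ ^ D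
  have hfm : Measurable f := by
    have := continuous_character_left e₀
    fun_prop
  have hin : IntegrableOn f (Metric.ball 0 1) := by
    refine integrableOn_ball_of_norm_le_rpow (C := (2 * Real.pi) ^ 2) (α := D - 2) hdim
      (by linarith) (ae_of_all _ fun h => ?_) hfm.aestronglyMeasurable
    rw [Real.norm_of_nonneg (by positivity)]
    rcases eq_or_ne h 0 with rfl | hh
    · have : f 0 = 0 := by simp [f, character]
      rw [this]
      positivity
    have hp : 0 < ‖h‖ := norm_pos_iff.2 hh
    have b1 := norm_character_sub_one_le h e₀
    rw [he, mul_one] at b1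
    have b2 : ‖h‖ ^ (-(D - 2)) = ‖h‖ ^ 2 / ‖h‖ ^ D := by
      rw [neg_sub, Real.rpow_sub hp, Real.rpow_two]
    rw [b2, ← mul_div_assoc, ← mul_pow]
    simp only [f]
    gcongr
  have hout : ∫⁻ h in (Metric.ball (0 : E) 1)ᶜ, ENNReal.ofReal (f h) < ∞ := by
    have h1 := finite_integral_one_add_norm (E := E) (μ := volume) (r := D) (by linarith)
    refine lt_of_le_of_lt ?_ (ENNReal.mul_lt_top (a := ENNReal.ofReal (4 * 2 ^ D))
      ENNReal.ofReal_lt_top h1)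
    rw [← lintegral_const_mul _ (by fun_prop)]
    refine le_trans ?_ (setLIntegral_le_lintegral (Metric.ball (0 : E) 1)ᶜ _)
    refine setLIntegral_mono' Metric.isOpen_ball.measurableSet.compl fun h hh => ?_
    rw [← ENNReal.ofReal_mul (by positivity)]
    apply ENNReal.ofReal_le_ofReal
    have hh1 : 1 ≤ ‖h‖ := by simpa using hh
    have b1 : ‖character h e₀ - 1‖ ^ 2 ≤ 4 := by
      have : ‖character h e₀ - 1‖ ≤ 2 := (norm_sub_le _ _).trans (by
        rw [norm_character, norm_one]; norm_num)
      nlinarith [norm_nonneg (character h e₀ - 1)]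
    have b2 : (1 + ‖h‖) ^ D ≤ 2 ^ D * ‖h‖ ^ D := by
      rw [← Real.mul_rpow (by norm_num) (norm_nonneg _)]
      exact Real.rpow_le_rpow (by positivity) (by linarith) (by positivity)
    rw [Real.rpow_neg (by positivity), mul_assoc, ← div_eq_mul_inv]
    simp only [f]
    have p1 : 0 < ‖h‖ ^ D := Real.rpow_pos_of_pos (by linarith) _
    have p2 : 0 < (1 + ‖h‖) ^ D := by positivity
    calc ‖character h e₀ - 1‖ ^ 2 / ‖h‖ ^ D ≤ 4 / ‖h‖ ^ D := by gcongr
      _ = 4 * (1 / ‖h‖ ^ D) := by ring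
      _ ≤ 4 * (2 ^ D / (1 + ‖h‖) ^ D) := by
        refine mul_le_mul_of_nonneg_left ?_ (by norm_num)
        rw [div_le_div_iff₀ p1 p2]
        linarith
  have : gagliardoSymbol s e₀ = (∫⁻ h in Metric.ball (0 : E) 1, ENNReal.ofReal (f h)) +
      ∫⁻ h in (Metric.ball (0 : E) 1)ᶜ, ENNReal.ofReal (f h) :=
    (lintegral_add_compl _ Metric.isOpen_ball.measurableSet).symm
  rw [this]
  refine ENNReal.add_ne_top.2 ⟨?_, hout.ne⟩
  have := hin.2
  rw [hasFiniteIntegral_iff_ofReal (ae_of_all _ fun h => by positivity)] at this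
  exact this.ne

theorem gagliardoSymbol_ne_zero (s : ℝ) {e₀ : E} (he : ‖e₀‖ = 1) : gagliardoSymbol s e₀ ≠ 0 := by
  have hcont := continuous_character_left e₀
  intro h0
  unfold gagliardoSymbol at h0
  rw [lintegral_eq_zero_iff (by fun_prop)] at h0
  set U : Set E := {h | character h e₀ - 1 ≠ 0}
  have hU : IsOpen U := isOpen_ne_fun (by fun_prop) continuous_const
  have hne : U.Nonempty := by
    -- The character at this point is exp(πi) = -1.
    refine ⟨(1 / 2 : ℝ) • e₀, ?_⟩
    simp only [U, mem_ofPred_eq, character, inner_smul_left, real_inner_self_eq_norm_sq, he]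
    have : (((2 * Real.pi * ((starRingEnd ℝ) (1 / 2) * 1 ^ 2) : ℝ) : ℂ) * Complex.I) =
        Real.pi * Complex.I := by
      push_cast
      simp
      ring
    rw [this, Complex.exp_pi_mul_I]
    norm_num
  have hz : volume U = 0 := by
    refine measure_mono_null (fun h hh => ?_) h0
    simp only [mem_compl_iff, mem_ofPred_eq, Pi.zero_apply, ENNReal.ofReal_eq_zero, not_le]
    have hh0 : h ≠ 0 := by
      rintro rfl
      exact hh (by simp [character])
    have p1 : 0 < ‖h‖ := norm_pos_iff.2 hh0
    have p2 : 0 < ‖character h e₀ - 1‖ := norm_pos_iff.2 hh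
    positivity
  exact (hU.measure_pos volume hne).ne' hz

end Kernel

/-! ### Comparison of full and directional energies -/

section Energy

variable {d : ℕ}

/-- The `2s`-homogeneous constant in front of the symbol in dimension `d`. -/
theorem exists_gagliardoSymbol_eq {s : ℝ} (hs : 0 < s) (hs1 : s < 1) (d : ℕ) (hd : 0 < d) :
    ∃ K : ℝ≥0∞, K ≠ 0 ∧ K ≠ ∞ ∧ ∀ ξ : EuclideanSpace ℝ (Fin d),
      gagliardoSymbol s ξ = ENNReal.ofReal (‖ξ‖ ^ (2 * s)) * K := by
  have he : ‖EuclideanSpace.single (⟨0, hd⟩ : Fin d) (1 : ℝ)‖ = 1 := by simp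
  exact ⟨_, gagliardoSymbol_ne_zero s he, gagliardoSymbol_ne_top hs hs1 he,
    gagliardoSymbol_eq hs he⟩

theorem exists_gagliardoSymbol_real_eq {s : ℝ} (hs : 0 < s) (hs1 : s < 1) :
    ∃ K : ℝ≥0∞, K ≠ 0 ∧ K ≠ ∞ ∧ ∀ t : ℝ,
      gagliardoSymbol s t = ENNReal.ofReal (|t| ^ (2 * s)) * K := by
  have he : ‖(1 : ℝ)‖ = 1 := by simp
  exact ⟨_, gagliardoSymbol_ne_zero s he, gagliardoSymbol_ne_top hs hs1 he, fun t => by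
    rw [gagliardoSymbol_eq hs he, Real.norm_eq_abs]⟩

/-- The Gagliardo energy of a scalar function on `ℝ^d`. -/
noncomputable def gagliardoEnergy (s : ℝ) (f : EuclideanSpace ℝ (Fin d) → ℝ) : ℝ≥0∞ :=
  ∫⁻ h : EuclideanSpace ℝ (Fin d), ∫⁻ x,
    ENNReal.ofReal ((f (x + h) - f x) ^ 2 / ‖h‖ ^ ((d : ℝ) + 2 * s))

theorem lintegral_increment_div {f : EuclideanSpace ℝ (Fin d) → ℝ}
    {F : EuclideanSpace ℝ (Fin d) → ℂ} (hF : IsL2Fourier (fun x => (f x : ℂ)) F)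
    (h : EuclideanSpace ℝ (Fin d)) {c : ℝ} (hc : 0 ≤ c) :
    ∫⁻ x, ENNReal.ofReal ((f (x + h) - f x) ^ 2 / c) =
      ∫⁻ ξ, ENNReal.ofReal (‖character h ξ - 1‖ ^ 2 / c) * ENNReal.ofReal (‖F ξ‖ ^ 2) := by
  have h1 := hF.lintegral_increment h
  have e1 : ∀ x, ENNReal.ofReal ((f (x + h) - f x) ^ 2 / c) =
      ENNReal.ofReal c⁻¹ * ENNReal.ofReal (‖(f (x + h) : ℂ) - f x‖ ^ 2) := by
    intro x
    rw [← ENNReal.ofReal_mul (inv_nonneg.2 hc), ← Complex.ofReal_sub, Complex.norm_real,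
      Real.norm_eq_abs, sq_abs, div_eq_inv_mul]
  have e2 : ∀ ξ, ENNReal.ofReal (‖character h ξ - 1‖ ^ 2 / c) * ENNReal.ofReal (‖F ξ‖ ^ 2) =
      ENNReal.ofReal c⁻¹ * ENNReal.ofReal (‖character h ξ - 1‖ ^ 2 * ‖F ξ‖ ^ 2) := by
    intro ξ
    rw [← ENNReal.ofReal_mul (by positivity), ← ENNReal.ofReal_mul (inv_nonneg.2 hc)]
    congr 1
    ring
  simp_rw [e1, e2]
  rw [lintegral_const_mul' _ _ ENNReal.ofReal_ne_top,
    lintegral_const_mul' _ _ ENNReal.ofReal_ne_top, h1]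

theorem continuous_character_uncurry {E : Type*} [NormedAddCommGroup E] [InnerProductSpace ℝ E] :
    Continuous fun p : E × E => character p.1 p.2 := by
  unfold character
  fun_prop

theorem gagliardoEnergy_eq {s : ℝ} {K : ℝ≥0∞}
    (hK : ∀ ξ : EuclideanSpace ℝ (Fin d),
      gagliardoSymbol s ξ = ENNReal.ofReal (‖ξ‖ ^ (2 * s)) * K)
    {f : EuclideanSpace ℝ (Fin d) → ℝ} {F : EuclideanSpace ℝ (Fin d) → ℂ}
    (hF : IsL2Fourier (fun x => (f x : ℂ)) F) (hK' : K ≠ ∞) :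
    gagliardoEnergy s f =
      K * ∫⁻ ξ, ENNReal.ofReal (‖ξ‖ ^ (2 * s)) * ENNReal.ofReal (‖F ξ‖ ^ 2) := by
  unfold gagliardoEnergy
  have e1 : ∀ h : EuclideanSpace ℝ (Fin d), ∫⁻ x,
      ENNReal.ofReal ((f (x + h) - f x) ^ 2 / ‖h‖ ^ ((d : ℝ) + 2 * s)) =
      ∫⁻ ξ, ENNReal.ofReal (‖character h ξ - 1‖ ^ 2 / ‖h‖ ^ ((d : ℝ) + 2 * s)) *
        ENNReal.ofReal (‖F ξ‖ ^ 2) := fun h => lintegral_increment_div hF h (by positivity)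
  simp_rw [e1]
  have hFm : AEMeasurable (fun ξ => ENNReal.ofReal (‖F ξ‖ ^ 2)) :=
    (hF.memLp_fourier.aestronglyMeasurable.aemeasurable.norm.pow_const 2).ennreal_ofReal
  have hm : Measurable fun p : EuclideanSpace ℝ (Fin d) × EuclideanSpace ℝ (Fin d) =>
      ENNReal.ofReal (‖character p.1 p.2 - 1‖ ^ 2 / ‖p.1‖ ^ ((d : ℝ) + 2 * s)) := by
    have := continuous_character_uncurry (E := EuclideanSpace ℝ (Fin d))
    fun_prop
  rw [lintegral_lintegral_swap (hm.aemeasurable.mul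
    (hFm.comp_quasiMeasurePreserving Measure.quasiMeasurePreserving_snd)),
    ← lintegral_const_mul' _ _ hK']
  refine lintegral_congr fun ξ => ?_
  rw [lintegral_mul_const' _ _ ENNReal.ofReal_ne_top, ← mul_assoc, mul_comm K, ← hK,
    gagliardoSymbol, finrank_euclideanSpace_fin]

theorem axisEnergy_eq {s : ℝ} {K : ℝ≥0∞}
    (hK : ∀ t : ℝ, gagliardoSymbol s t = ENNReal.ofReal (|t| ^ (2 * s)) * K) (hK' : K ≠ ∞)
    (j : Fin d) {f : EuclideanSpace ℝ (Fin d) → ℝ} {F : EuclideanSpace ℝ (Fin d) → ℂ}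
    (hF : IsL2Fourier (fun x => (f x : ℂ)) F) :
    axisEnergy s j f =
      K * ∫⁻ ξ, ENNReal.ofReal (|ξ j| ^ (2 * s)) * ENNReal.ofReal (‖F ξ‖ ^ 2) := by
  unfold axisEnergy
  have ec : ∀ (τ : ℝ) (ξ : EuclideanSpace ℝ (Fin d)),
      character (τ • EuclideanSpace.single j (1 : ℝ)) ξ = character τ (ξ j) := by
    intro τ ξ
    simp [character, inner_smul_left, EuclideanSpace.inner_single_left, mul_comm]
  have e1 : ∀ τ : ℝ, ∫⁻ x, ENNReal.ofReal
      ((f (x + τ • EuclideanSpace.single j (1 : ℝ)) - f x) ^ 2 / |τ| ^ (1 + 2 * s)) =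
      ∫⁻ ξ : EuclideanSpace ℝ (Fin d),
        ENNReal.ofReal (‖character τ (ξ j) - 1‖ ^ 2 / |τ| ^ (1 + 2 * s)) *
        ENNReal.ofReal (‖F ξ‖ ^ 2) := fun τ => by
    rw [lintegral_increment_div hF _ (by positivity)]
    simp_rw [ec]
  simp_rw [e1]
  have hFm : AEMeasurable (fun ξ => ENNReal.ofReal (‖F ξ‖ ^ 2)) :=
    (hF.memLp_fourier.aestronglyMeasurable.aemeasurable.norm.pow_const 2).ennreal_ofReal
  have hm : Measurable fun p : ℝ × EuclideanSpace ℝ (Fin d) =>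
      ENNReal.ofReal (‖character p.1 (p.2 j) - 1‖ ^ 2 / |p.1| ^ (1 + 2 * s)) := by
    have : Continuous fun p : ℝ × EuclideanSpace ℝ (Fin d) => character p.1 (p.2 j) :=
      (continuous_character_uncurry (E := ℝ)).comp
        (show Continuous fun p : ℝ × EuclideanSpace ℝ (Fin d) => (p.1, p.2 j) by fun_prop)
    exact (((this.measurable.sub_const 1).norm.pow_const 2).div (by fun_prop)).ennreal_ofReal
  rw [lintegral_lintegral_swap (hm.aemeasurable.mul
    (hFm.comp_quasiMeasurePreserving Measure.quasiMeasurePreserving_snd)),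
    ← lintegral_const_mul' _ _ hK']
  refine lintegral_congr fun ξ => ?_
  rw [lintegral_mul_const' _ _ ENNReal.ofReal_ne_top, ← mul_assoc, mul_comm K, ← hK,
    gagliardoSymbol]
  simp

/-- The pointwise inequality |ξ_j| ≤ ‖ξ‖ between the symbols; each side is multiplied by the other's
constant to avoid division. -/
theorem axisEnergy_le {s : ℝ} (hs : 0 < s) {K₁ K : ℝ≥0∞}
    (hK₁ : ∀ t : ℝ, gagliardoSymbol s t = ENNReal.ofReal (|t| ^ (2 * s)) * K₁) (hK₁' : K₁ ≠ ∞)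
    (hK : ∀ ξ : EuclideanSpace ℝ (Fin d),
      gagliardoSymbol s ξ = ENNReal.ofReal (‖ξ‖ ^ (2 * s)) * K) (hK' : K ≠ ∞)
    (j : Fin d) {f : EuclideanSpace ℝ (Fin d) → ℝ} (hf : MemLp f 2) :
    K * axisEnergy s j f ≤ K₁ * gagliardoEnergy s f := by
  have hf' : MemLp (fun x => (f x : ℂ)) 2 := hf.ofReal
  obtain ⟨F, hF⟩ := hf'.exists_isL2Fourier
  rw [axisEnergy_eq (f := f) hK₁ hK₁' j hF, gagliardoEnergy_eq (f := f) hK hF hK', mul_left_comm]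
  gcongr with ξ
  exact PiLp.norm_apply_le ξ j

/-- The power-mean inequality with exponent 1 + s for the numbers ξ_j²; its constant is d^{(1+s)-1}.
-/
theorem norm_rpow_le_sum (s : ℝ) (hs : 0 < s) (ξ : EuclideanSpace ℝ (Fin d)) :
    ‖ξ‖ ^ (2 * s) * ‖ξ‖ ^ 2 ≤ (d : ℝ) ^ s * ∑ j, |ξ j| ^ (2 * s) * (ξ j) ^ 2 := by
  have h := Real.rpow_sum_le_const_mul_sum_rpow_of_nonneg (Finset.univ : Finset (Fin d))
    (f := fun j => (ξ j) ^ 2) (p := 1 + s) (by linarith) (fun j _ => sq_nonneg _)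
  have e : ∀ a : ℝ, |a| ^ (2 * s) * a ^ 2 = (a ^ 2) ^ (1 + s) := by
    intro a
    rw [← sq_abs a, ← Real.rpow_natCast, ← Real.rpow_mul (abs_nonneg a)]
    rcases eq_or_ne a 0 with rfl | ha
    · have : (2 : ℝ) * (1 + s) ≠ 0 := by positivity
      simp [Real.zero_rpow this]
    · rw [← Real.rpow_add (abs_pos.2 ha)]
      congr 1
      push_cast
      ring
  have e0 := e ‖ξ‖
  rw [abs_norm] at e0
  rw [e0, EuclideanSpace.norm_sq_eq]
  simp_rw [e]
  simpa using h

/-- For gradients, the full energy is controlled by the pure directional energies. -/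
theorem sum_gagliardoEnergy_le {s : ℝ} (hs : 0 < s) {K₁ K : ℝ≥0∞}
    (hK₁ : ∀ t : ℝ, gagliardoSymbol s t = ENNReal.ofReal (|t| ^ (2 * s)) * K₁) (hK₁' : K₁ ≠ ∞)
    (hK : ∀ ξ : EuclideanSpace ℝ (Fin d),
      gagliardoSymbol s ξ = ENNReal.ofReal (‖ξ‖ ^ (2 * s)) * K) (hK' : K ≠ ∞)
    {w : EuclideanSpace ℝ (Fin d) → ℝ} {H : Fin d → EuclideanSpace ℝ (Fin d) → ℝ}
    (hw : MemLp w 2) (hH : ∀ j, MemLp (H j) 2)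
    (h : ∀ (j : Fin d) (φ : EuclideanSpace ℝ (Fin d) → ℝ),
      ContDiff ℝ (⊤ : ℕ∞) φ → HasCompactSupport φ →
      ∫ x, w x * fderiv ℝ φ x (EuclideanSpace.single j (1 : ℝ)) = - ∫ x, H j x * φ x) :
    K₁ * ∑ j, gagliardoEnergy s (H j) ≤
      ENNReal.ofReal ((d : ℝ) ^ s) * (K * ∑ j, axisEnergy s j (H j)) := by
  have hw' : MemLp (fun x => (w x : ℂ)) 2 := hw.ofReal
  have hH' : ∀ j, MemLp (fun x => (H j x : ℂ)) 2 := fun j => (hH j).ofReal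
  obtain ⟨W, hW⟩ := hw'.exists_isL2Fourier
  choose F hF using fun j => (hH' j).exists_isL2Fourier
  -- The gradient structure enters here: all components have transforms proportional to ξ_j times
  -- one function W.
  have hFW : ∀ j, (fun ξ => ENNReal.ofReal (‖F j ξ‖ ^ 2)) =ᵐ[volume] fun ξ =>
      ENNReal.ofReal ((ξ j) ^ 2) * ENNReal.ofReal ((2 * Real.pi * ‖W ξ‖) ^ 2) := by
    intro j
    filter_upwards [fourier_weakDeriv_ae_eq hw (hH j) (h j) hW (hF j)] with ξ hξ
    rw [hξ, ← ENNReal.ofReal_mul (sq_nonneg _)]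
    congr 1
    simp [abs_of_pos Real.pi_pos, EuclideanSpace.inner_single_right]
    rw [← sq_abs (ξ j)]
    ring
  have hWm : AEMeasurable (fun ξ => ENNReal.ofReal ((2 * Real.pi * ‖W ξ‖) ^ 2)) :=
    ((hW.memLp_fourier.aestronglyMeasurable.aemeasurable.norm.const_mul _).pow_const
      2).ennreal_ofReal
  have e1 : ∑ j, gagliardoEnergy s (H j) = K * ∫⁻ ξ : EuclideanSpace ℝ (Fin d),
      ENNReal.ofReal (‖ξ‖ ^ (2 * s) * ‖ξ‖ ^ 2) * ENNReal.ofReal ((2 * Real.pi * ‖W ξ‖) ^ 2) := by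
    rw [Finset.sum_congr rfl fun j _ => gagliardoEnergy_eq (f := H j) hK (hF j) hK']
    rw [← Finset.mul_sum]
    congr 1
    have : ∀ j, ∫⁻ ξ, ENNReal.ofReal (‖ξ‖ ^ (2 * s)) * ENNReal.ofReal (‖F j ξ‖ ^ 2) =
        ∫⁻ ξ : EuclideanSpace ℝ (Fin d), ENNReal.ofReal (‖ξ‖ ^ (2 * s)) *
          (ENNReal.ofReal ((ξ j) ^ 2) * ENNReal.ofReal ((2 * Real.pi * ‖W ξ‖) ^ 2)) := by
      intro j
      refine lintegral_congr_ae ?_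
      filter_upwards [hFW j] with ξ hξ
      rw [hξ]
    simp_rw [this]
    rw [← lintegral_finsetSum' _ (fun j _ => by fun_prop)]
    refine lintegral_congr fun ξ => ?_
    rw [← Finset.mul_sum, ← Finset.sum_mul, ← mul_assoc,
      ← ENNReal.ofReal_sum_of_nonneg (fun j _ => sq_nonneg _),
      ENNReal.ofReal_mul (by positivity), EuclideanSpace.real_norm_sq_eq]
  have e2 : ∑ j, axisEnergy s j (H j) = K₁ * ∫⁻ ξ : EuclideanSpace ℝ (Fin d),
      ENNReal.ofReal (∑ j, |ξ j| ^ (2 * s) * (ξ j) ^ 2) *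
        ENNReal.ofReal ((2 * Real.pi * ‖W ξ‖) ^ 2) := by
    rw [Finset.sum_congr rfl fun j _ => axisEnergy_eq (f := H j) hK₁ hK₁' j (hF j)]
    rw [← Finset.mul_sum]
    congr 1
    have : ∀ j, ∫⁻ ξ : EuclideanSpace ℝ (Fin d),
        ENNReal.ofReal (|ξ j| ^ (2 * s)) * ENNReal.ofReal (‖F j ξ‖ ^ 2) =
        ∫⁻ ξ : EuclideanSpace ℝ (Fin d), ENNReal.ofReal (|ξ j| ^ (2 * s)) *
          (ENNReal.ofReal ((ξ j) ^ 2) * ENNReal.ofReal ((2 * Real.pi * ‖W ξ‖) ^ 2)) := by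
      intro j
      refine lintegral_congr_ae ?_
      filter_upwards [hFW j] with ξ hξ
      rw [hξ]
    simp_rw [this]
    rw [← lintegral_finsetSum' _ (fun j _ => by fun_prop)]
    refine lintegral_congr fun ξ => ?_
    rw [ENNReal.ofReal_sum_of_nonneg (fun j _ => by positivity), Finset.sum_mul]
    refine Finset.sum_congr rfl fun j _ => ?_
    rw [ENNReal.ofReal_mul (by positivity), ← mul_assoc]
  rw [e1, e2]
  rw [show ∀ a b c e : ℝ≥0∞, a * (b * (c * e)) = c * (b * (a * e)) from fun a b c e => by ring,
    ← lintegral_const_mul' _ _ ENNReal.ofReal_ne_top]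
  refine mul_le_mul_right (mul_le_mul_right (lintegral_mono fun ξ => ?_) _) _
  rw [← mul_assoc, ← ENNReal.ofReal_mul (p := (d : ℝ) ^ s) (by positivity)]
  exact mul_le_mul_left (ENNReal.ofReal_le_ofReal (norm_rpow_le_sum s hs ξ)) _

end Energy

/-! ### The positive part in H^{1+s} -/

section PositivePart

variable {d : ℕ} {u u' : EuclideanSpace ℝ (Fin d) → ℝ}
  {G G' : EuclideanSpace ℝ (Fin d) → EuclideanSpace ℝ (Fin d)}

theorem memLp_coord (hG : MemLp G 2) (j : Fin d) : MemLp (fun x => G x j) 2 :=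
  hG.mono ((EuclideanSpace.proj (𝕜 := ℝ) j).continuous.comp_aestronglyMeasurable
    hG.aestronglyMeasurable) (ae_of_all _ fun x => PiLp.norm_apply_le (G x) j)

theorem lintegral_lintegral_sum_swap {ι α β : Type*} [Fintype ι] [MeasurableSpace α]
    [MeasurableSpace β] {μ : Measure α} {ν : Measure β} [SFinite μ] [SFinite ν]
    {k : ι → β → α → ℝ≥0∞} (hk : ∀ j, Measurable (Function.uncurry (k j))) :
    ∫⁻ x, ∫⁻ h, ∑ j, k j h x ∂ν ∂μ = ∑ j, ∫⁻ h, ∫⁻ x, k j h x ∂μ ∂ν := by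
  have hm : ∀ j, Measurable fun h => ∫⁻ x, k j h x ∂μ := fun j => (hk j).lintegral_prod_right'
  have hsum : Measurable (Function.uncurry fun x h => ∑ j, k j h x) :=
    Finset.measurable_sum _ fun j _ => (hk j).comp measurable_swap
  rw [lintegral_lintegral_swap hsum.aemeasurable, ← lintegral_finsetSum _ fun j _ => hm j]
  exact lintegral_congr fun h => lintegral_finsetSum _ fun j _ =>
    (hk j).comp measurable_prodMk_left

theorem gagliardoSeminorm_eq (s : ℝ) (hG : Measurable G) :
    gagliardoSeminorm s G = (∑ j, gagliardoEnergy s (fun x => G x j)) ^ (1 / 2 : ℝ) := by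
  unfold gagliardoSeminorm gagliardoEnergy
  have hm : ∀ j, Measurable (Function.uncurry fun h x : EuclideanSpace ℝ (Fin d) =>
      ENNReal.ofReal ((G (x + h) j - G x j) ^ 2 / ‖h‖ ^ ((d : ℝ) + 2 * s))) := fun j => by
    have hGj : Measurable fun x => G x j := by fun_prop
    have h1 := hGj.comp (show Measurable fun p : EuclideanSpace ℝ (Fin d) ×
      EuclideanSpace ℝ (Fin d) => p.2 + p.1 by fun_prop)
    have h2 := hGj.comp (show Measurable fun p : EuclideanSpace ℝ (Fin d) ×
      EuclideanSpace ℝ (Fin d) => p.2 by fun_prop)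
    exact (((h1.sub h2).pow_const 2).div (by fun_prop)).ennreal_ofReal
  have e1 : ∀ x, ∫⁻ y, ENNReal.ofReal (‖G x - G y‖ ^ 2 / ‖x - y‖ ^ ((d : ℝ) + 2 * s)) =
      ∫⁻ h, ∑ j, ENNReal.ofReal ((G (x + h) j - G x j) ^ 2 / ‖h‖ ^ ((d : ℝ) + 2 * s)) := by
    intro x
    rw [← lintegral_add_left_eq_self _ x]
    refine lintegral_congr fun h => ?_
    rw [← ENNReal.ofReal_sum_of_nonneg (fun j _ => by positivity), ← Finset.sum_div,
      norm_sub_rev, EuclideanSpace.real_norm_sq_eq, norm_sub_rev x, add_sub_cancel_left]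
    rfl
  rw [lintegral_congr e1, lintegral_lintegral_sum_swap hm]

theorem gagliardoSeminorm_congr (s : ℝ) (h : G =ᵐ[volume] G') :
    gagliardoSeminorm s G = gagliardoSeminorm s G' := by
  unfold gagliardoSeminorm
  congr 1
  refine lintegral_congr_ae ?_
  filter_upwards [h] with x hx
  refine lintegral_congr_ae ?_
  filter_upwards [h] with y hy
  rw [hx, hy]

theorem h1NormWith_congr (hu : u =ᵐ[volume] u') (hG : G =ᵐ[volume] G') :
    h1NormWith u G = h1NormWith u' G' := by
  unfold h1NormWith
  rw [eLpNorm_congr_ae hu, eLpNorm_congr_ae hG]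

theorem IsWeakGradient.congr (h : IsWeakGradient u G) (hu : u =ᵐ[volume] u')
    (hG : G =ᵐ[volume] G') : IsWeakGradient u' G' where
  locallyIntegrable := h.locallyIntegrable.congr hu
  locallyIntegrable_grad := h.locallyIntegrable_grad.congr hG
  integral_eq j φ hφ hc := by
    have e1 : ∫ x, u' x * fderiv ℝ φ x (EuclideanSpace.single j (1 : ℝ)) =
        ∫ x, u x * fderiv ℝ φ x (EuclideanSpace.single j (1 : ℝ)) :=
      integral_congr_ae (by filter_upwards [hu] with x hx; rw [hx])
    have e2 : ∫ x, G' x j * φ x = ∫ x, G x j * φ x :=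
      integral_congr_ae (by filter_upwards [hG] with x hx; rw [hx])
    rw [e1, e2, h.integral_eq j φ hφ hc]

theorem positivePart_congr (hu : u =ᵐ[volume] u') :
    positivePart u =ᵐ[volume] positivePart u' := by
  filter_upwards [hu] with x hx
  simp [positivePart, hx]

theorem h1NormWith_positivePart_le :
    h1NormWith (positivePart u) ({x | 0 < u x}.indicator G) ≤ h1NormWith u G := by
  unfold h1NormWith
  have h1 : eLpNorm (positivePart u) 2 volume ≤ eLpNorm u 2 volume :=
    eLpNorm_mono fun x => by
      rw [Real.norm_eq_abs, Real.norm_eq_abs, positivePart, abs_of_nonneg (le_max_right _ _)]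
      exact max_le (le_abs_self _) (abs_nonneg _)
  have h2 : eLpNorm ({x | 0 < u x}.indicator G) 2 volume ≤ eLpNorm G 2 volume :=
    eLpNorm_indicator_le G
  gcongr

theorem eLpNorm_lt_top_of_h1NormWith (h : h1NormWith u G < ∞) :
    eLpNorm u 2 volume < ∞ ∧ eLpNorm G 2 volume < ∞ := by
  unfold h1NormWith at h
  rw [ENNReal.rpow_lt_top_iff_of_pos (by norm_num), ENNReal.add_lt_top] at h
  exact ⟨(ENNReal.pow_lt_top_iff.1 h.1).resolve_right two_ne_zero,
    (ENNReal.pow_lt_top_iff.1 h.2).resolve_right two_ne_zero⟩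

/-- The chain rule for the positive part. -/
theorem IsWeakGradient.positivePart {n : ℕ} {u : EuclideanSpace ℝ (Fin (n + 1)) → ℝ}
    {G : EuclideanSpace ℝ (Fin (n + 1)) → EuclideanSpace ℝ (Fin (n + 1))}
    (h : IsWeakGradient u G) (hum : Measurable u) (hGm : Measurable G) (hG : MemLp G 2) :
    IsWeakGradient (FracSobolev.positivePart u) ({x | 0 < u x}.indicator G) where
  locallyIntegrable := by
    refine h.locallyIntegrable.mono (hum.max measurable_const).aestronglyMeasurable
      (ae_of_all _ fun x => ?_)
    rw [Real.norm_eq_abs, Real.norm_eq_abs, FracSobolev.positivePart,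
      abs_of_nonneg (le_max_right _ _)]
    exact max_le (le_abs_self _) (abs_nonneg _)
  locallyIntegrable_grad :=
    h.locallyIntegrable_grad.indicator (measurableSet_lt measurable_const hum)
  integral_eq j φ hφ hc := by
    have hGj := memLp_coord hG j
    have hgm : Measurable fun x => G x j := by fun_prop
    have hg := hGj.locallyIntegrable one_le_two
    have := integral_max_zero_mul_fderiv hum hgm hGj.integrable_sq.lintegral_lt_top.ne
      h.locallyIntegrable hg (ae_shift_sub_eq hum hgm h.locallyIntegrable hg (h.integral_eq j))
      hφ hc
    refine this.trans ?_
    congr 2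
    ext x
    by_cases hx : 0 < u x <;> simp [indicator, hx]

/-- The truncated field is the weak gradient of u⁺, so its full energy reduces to the energies of
its j-th components in direction j. There the one-dimensional bound removes the truncation, and the
directional energy of ∂_j u is at most a multiple of its full energy. -/
theorem exists_gagliardoSeminorm_indicator_le {s : ℝ} (hs : 0 < s) (hs1 : s < 1 / 2) (n : ℕ) :
    ∃ C : ℝ≥0, ∀ (u : EuclideanSpace ℝ (Fin (n + 1)) → ℝ)
      (G : EuclideanSpace ℝ (Fin (n + 1)) → EuclideanSpace ℝ (Fin (n + 1))),
      IsWeakGradient u G → Measurable u → Measurable G → MemLp u 2 → MemLp G 2 →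
      gagliardoSeminorm s ({x | 0 < u x}.indicator G) ≤ C * gagliardoSeminorm s G := by
  obtain ⟨K₁, hK₁0, hK₁', hK₁⟩ := exists_gagliardoSymbol_real_eq hs (by linarith : s < 1)
  obtain ⟨K, hK0, hK', hK⟩ :=
    exists_gagliardoSymbol_eq hs (by linarith : s < 1) (n + 1) n.succ_pos
  obtain ⟨C, hC⟩ := axisEnergy_indicator_le hs hs1
  refine ⟨(Real.toNNReal (((n + 1 : ℕ) : ℝ) ^ s) * C) ^ (1 / 2 : ℝ),
    fun u G h hum hGm hu hG => ?_⟩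
  have hO : MeasurableSet {x | 0 < u x} := measurableSet_lt measurable_const hum
  have hH2 : MemLp ({x | 0 < u x}.indicator G) 2 := hG.indicator hO
  have hw : MemLp (FracSobolev.positivePart u) 2 :=
    hu.mono (hum.max measurable_const).aestronglyMeasurable (ae_of_all _ fun x => by
      rw [Real.norm_eq_abs, Real.norm_eq_abs, FracSobolev.positivePart,
        abs_of_nonneg (le_max_right _ _)]
      exact max_le (le_abs_self _) (abs_nonneg _))
  rw [gagliardoSeminorm_eq s hGm, gagliardoSeminorm_eq s (hGm.indicator hO),
    ENNReal.coe_rpow_of_nonneg _ (by norm_num), ← ENNReal.mul_rpow_of_nonneg _ _ (by norm_num)]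
  refine ENNReal.rpow_le_rpow ?_ (by norm_num)
  have h1 := sum_gagliardoEnergy_le hs hK₁ hK₁' hK hK' hw (fun j => memLp_coord hH2 j)
    (h.positivePart hum hGm hG).integral_eq
  have h2 : ∀ j, K * axisEnergy s j (fun x => {x | 0 < u x}.indicator G x j) ≤
      K₁ * (C * gagliardoEnergy s fun x => G x j) := by
    intro j
    have hGj := memLp_coord hG j
    have hgm : Measurable fun x => G x j := by fun_prop
    have hg := hGj.locallyIntegrable one_le_two
    have h3 := hC n j u _ hum hgm hGj.integrable_sq.lintegral_lt_top.ne
      (ae_shift_sub_eq hum hgm h.locallyIntegrable hg (h.integral_eq j))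
    have e : (fun x => {x | 0 < u x}.indicator G x j) =
        {x | 0 < u x}.indicator fun x => G x j := by
      ext x
      by_cases hx : 0 < u x <;> simp [indicator, hx]
    rw [e]
    calc _ ≤ K * (C * axisEnergy s j fun x => G x j) := mul_le_mul_right h3 _
      _ = C * (K * axisEnergy s j fun x => G x j) := mul_left_comm _ _ _
      _ ≤ C * (K₁ * gagliardoEnergy s fun x => G x j) :=
        mul_le_mul_right (axisEnergy_le hs hK₁ hK₁' hK hK' j hGj) _
      _ = _ := mul_left_comm _ _ _
  -- Both sides carry K₁, which is neither 0 nor ∞ and so cancels.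
  refine (ENNReal.mul_le_mul_iff_right hK₁0 hK₁').1 (h1.trans ?_)
  rw [Finset.mul_sum]
  calc _ ≤ ENNReal.ofReal (((n + 1 : ℕ) : ℝ) ^ s) *
        ∑ j, K₁ * (C * gagliardoEnergy s fun x => G x j) :=
        mul_le_mul_right (Finset.sum_le_sum fun j _ => h2 j) _
    _ = _ := by
      rw [← Finset.mul_sum, ← Finset.mul_sum, ENNReal.coe_mul, ENNReal.ofReal]
      ring

theorem exists_sobolevNorm_positivePart_le {s : ℝ} (hs : 0 < s) (hs1 : s < 1 / 2) (n : ℕ) :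
    ∃ C : ℝ≥0, 0 < C ∧ ∀ u : EuclideanSpace ℝ (Fin (n + 1)) → ℝ,
      sobolevNorm s (positivePart u) ≤ C * sobolevNorm s u := by
  obtain ⟨C, hC⟩ := exists_gagliardoSeminorm_indicator_le hs hs1 n
  -- The 1 serves the H¹ part and C the seminorm; being nonzero and finite, the constant passes
  -- through the infima.
  refine ⟨1 + C, by positivity, fun u => ?_⟩
  have hC0 : ((1 + C : ℝ≥0) : ℝ≥0∞) ≠ 0 := by
    rw [Ne, ENNReal.coe_eq_zero]
    positivity
  rw [sobolevNorm.eq_1 s u, ENNReal.mul_iInf_of_ne hC0 ENNReal.coe_ne_top]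
  refine le_iInf fun G => ?_
  rw [ENNReal.mul_iInf_of_ne hC0 ENNReal.coe_ne_top]
  refine le_iInf fun h => ?_
  rcases eq_or_ne (h1NormWith u G) ∞ with htop | htop
  · rw [htop, top_add, ENNReal.mul_top hC0]
    exact le_top
  obtain ⟨hu2, hG2⟩ := eLpNorm_lt_top_of_h1NormWith (lt_top_iff_ne_top.2 htop)
  have hu : MemLp u 2 := ⟨h.locallyIntegrable.aestronglyMeasurable, hu2⟩
  have hG : MemLp G 2 := ⟨h.locallyIntegrable_grad.aestronglyMeasurable, hG2⟩
  have eu := hu.aestronglyMeasurable.ae_eq_mk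
  have eG := hG.aestronglyMeasurable.ae_eq_mk
  have hum := hu.aestronglyMeasurable.stronglyMeasurable_mk.measurable
  have hGm := hG.aestronglyMeasurable.stronglyMeasurable_mk.measurable
  -- Slicing needs genuinely measurable functions; all the quantities involved are unchanged on null
  -- sets.
  set v := hu.aestronglyMeasurable.mk u
  set V := hG.aestronglyMeasurable.mk G
  have hv := (memLp_congr_ae eu).1 hu
  have hV := (memLp_congr_ae eG).1 hG
  have hvV := h.congr eu eG
  have hw := (hvV.positivePart hum hGm hV).congr (positivePart_congr eu.symm)
    (Filter.EventuallyEq.refl _ _)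
  rw [h1NormWith_congr eu eG, gagliardoSeminorm_congr s eG]
  refine (iInf₂_le _ hw).trans ?_
  rw [h1NormWith_congr (positivePart_congr eu) (Filter.EventuallyEq.refl _ _)]
  rw [mul_add]
  refine add_le_add (h1NormWith_positivePart_le.trans (le_mul_of_one_le_left' ?_))
    ((hC v V hvV hum hGm hv hV).trans (mul_le_mul_left ?_ _))
  · exact_mod_cast le_self_add
  · exact_mod_cast le_add_self

end PositivePart

end FracSobolev

theorem mainTheorem4 (s : ℝ) (hs0 : 0 < s) (hs1 : s < 1 / 2) (d : ℕ) (hd : 2 ≤ d) :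
    ∃ C : ℝ≥0, 0 < C ∧
      ∀ u : EuclideanSpace ℝ (Fin d) → ℝ, FracSobolev.MemSobolev s u →
        FracSobolev.MemSobolev s (FracSobolev.positivePart u) ∧
        FracSobolev.sobolevNorm s (FracSobolev.positivePart u) ≤
          (C : ℝ≥0∞) * FracSobolev.sobolevNorm s u := by
  obtain ⟨n, rfl⟩ : ∃ n, d = n + 1 := ⟨d - 1, by omega⟩
  obtain ⟨C, hC0, hC⟩ := FracSobolev.exists_sobolevNorm_positivePart_le hs0 hs1 n
  exact ⟨C, hC0, fun u hu => ⟨(hC u).trans_lt (ENNReal.mul_lt_top ENNReal.coe_lt_top hu), hC u⟩⟩
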